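/- Let $\mathfrak g$ be the real vector space with basis $X_1,\dots,X_{10}$ and the bilinear antisymmetric bracket given by $$\begin{aligned} &[X_1,X_2]=2X_2,\ [X_1,X_3]=-2X_3,\ [X_2,X_3]=X_1,\ [X_1,X_4]=X_4,\ [X_1,X_5]=-X_5,\ [X_1,X_6]=X_6,\ [X_1,X_7]=-X_7,\\ &[X_1,X_8]=2X_8,\ [X_1,X_{10}]=-2X_{10},\ [X_2,X_5]=X_4,\ [X_2,X_7]=X_6,\ [X_2,X_9]=2X_8,\ [X_2,X_{10}]=X_9,\ [X_3,X_4]=X_5,\\ &[X_3,X_6]=X_7,\ [X_3,X_8]=X_9,\ [X_3,X_9]=2X_{10},\ [X_4,X_6]=2X_8,\ [X_4,X_7]=X_9,\ [X_5,X_6]=X_9,\ [X_5,X_7]=2X_{10}, \end{aligned}$$ all other brackets $[X_i,X_j]$ with $i<j$ being zero. This is a real Lie algebra of dimension ten, and the following hold. 1. The radical $\mathfrak r$ of $\mathfrak g$ is spanned by $X_4,\dots,X_{10}$, and $\mathfrak g$ is a semidirect sum $\mathfrak{sl}(2,\mathbb R)\ltimes\mathfrak r$ in which $\mathfrak{sl}(2,\mathbb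 R)$ acts on $\mathfrak r$ by $D_1\oplus 2D_{1/2}$, where $D_1$ is the adjoint and $D_{1/2}$ the standard two-dimensional representation. 2. Write the quadratic polynomial $C=x_1x_9+2(x_2x_{10}-x_3x_8)+x_4x_7-x_5x_6$ as $\sum_{a,b}g^{ab}x_ax_b$ with $g^{ab}=g^{ba}$. Then the matrix $(g^{ab})$ is invertible and $\sum_{a,b}g^{ab}X_aX_b$ lies in the centre of the universal enveloping algebra of $\mathfrak g$; that is, $C$ defines a non-degenerate quadratic Casimir operator of $\mathfrak g$. 3. $\mathfrak g$ is quasi-classical: it admits a non-degenerate symmetric bilinear form with $(X,[Y,Z])=([X,Y],Z)$ for all $X,Y,Z$. It is not reductive, i.e. it is not the direct sum of a semisimple ideal and an abelian ideal. 4. For the cohomology with values in the adjoint representation, $\dim Z^2(\mathfrak g,\mathfrak g)=\dim B^2(\mathfrak g,\mathfrak g)=86$, hence $H^2(\mathfrak g,\mathfrak g)=0$. 5. $\mathfrak g$ is rigid (stable): its $GL(10,\mathbb R)$-orbit is open, for the Euclidean topology, in the variety of ten-dimensional real Lie algebra laws (structure constants). 6. Say that a finite-dimensional real Lie algebra $\mathfrak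 h$ contracts onto $\mathfrak g$ if there are invertible linear maps $\Phi_t$ of $\mathfrak h$ $(t\in\mathbb R)$ such that the limit $\lim_{t\to\infty}\Phi_t^{-1}[\Phi_t(X),\Phi_t(Y)]$ exists for all $X,Y\in\mathfrak h$ and, as a bracket on the vector space $\mathfrak h$, defines a Lie algebra isomorphic to $\mathfrak g$. Every finite-dimensional real Lie algebra that contracts onto $\mathfrak g$ is isomorphic to $\mathfrak g$; in particular $\mathfrak g$ is not a contraction of any reductive Lie algebra. -/

import Mathlib

open Filter Topology

/-! ### Quasi-classical, reductive and rigid Lie algebras, contractions -/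

section General

universe u v

/-- A real Lie algebra is quasi-classical if it carries a non-degenerate symmetric bilinear form
with `(x, [y, z]) = ([x, y], z)`. -/
def IsQuasiClassical (L : Type u) [LieRing L] [LieAlgebra ℝ L] : Prop :=
  ∃ B : LinearMap.BilinForm ℝ L,
    (∀ x y, B x y = B y x) ∧
    (∀ x y z, B x ⁅y, z⁆ = B ⁅x, y⁆ z) ∧
    (∀ x, (∀ y, B x y = 0) → x = 0)

/-- A real Lie algebra is reductive if it is the direct sum of a semisimple ideal and an abelian
ideal. -/
def IsReductiveLie (L : Type u) [LieRing L] [LieAlgebra ℝ L] : Prop :=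
  ∃ S A : LieIdeal ℝ L, IsCompl S A ∧ LieAlgebra.HasTrivialRadical ℝ S ∧ IsLieAbelian A

/-- The quadratic element `∑ q_ab X_a X_b` of the universal enveloping algebra. -/
noncomputable def quadraticOperator {L : Type u} [LieRing L] [LieAlgebra ℝ L] {n : ℕ}
    (X : Module.Basis (Fin n) ℝ L) (q : Matrix (Fin n) (Fin n) ℝ) :
    UniversalEnvelopingAlgebra ℝ L :=
  ∑ a, ∑ b, q a b •
    (UniversalEnvelopingAlgebra.ι ℝ (X a) * UniversalEnvelopingAlgebra.ι ℝ (X b))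

/-- The space `Z²(L, L)` of alternating bilinear maps `L × L → L` that are cocycles for the adjoint
representation. -/
def adjointZ2 (L : Type u) [LieRing L] [LieAlgebra ℝ L] : Submodule ℝ (L →ₗ[ℝ] L →ₗ[ℝ] L) :=
  (LieModule.Cohomology.twoCocycle ℝ L L).map (LieModule.Cohomology.twoCochain ℝ L L).subtype

/-- The space `B²(L, L)` of coboundaries `(x, y) ↦ [x, f y] - [y, f x] - f [x, y]`. -/
def adjointB2 (L : Type u) [LieRing L] [LieAlgebra ℝ L] : Submodule ℝ (L →ₗ[ℝ] L →ₗ[ℝ] L) :=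
  LinearMap.range
    ((LieModule.Cohomology.twoCochain ℝ L L).subtype ∘ₗ LieModule.Cohomology.d₁₂ ℝ L L)

/-- The quotient of `Z` by `B`, for subspaces `B ⊆ Z` of a vector space. -/
abbrev subquotient {V : Type u} [AddCommGroup V] [Module ℝ V] (Z B : Submodule ℝ V) : Type u :=
  Z ⧸ B.submoduleOf Z

/-- The coboundaries are cocycles. -/
theorem adjointB2_le_adjointZ2 (L : Type u) [LieRing L] [LieAlgebra ℝ L] :
    adjointB2 L ≤ adjointZ2 L := by
  rintro _ ⟨f, rfl⟩
  refine ⟨LieModule.Cohomology.d₁₂ ℝ L L f, ?_, rfl⟩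
  exact (LieModule.Cohomology.mem_twoCocycle_iff ℝ L L _).2
    (LinearMap.congr_fun (LieModule.Cohomology.d₂₃_comp_d₁₂ ℝ L L) f)

/-- The second adjoint cohomology space `H²(L, L) = Z²(L, L) / B²(L, L)`. -/
abbrev adjointH2 (L : Type u) [LieRing L] [LieAlgebra ℝ L] : Type u :=
  subquotient (adjointZ2 L) (adjointB2 L)

/-- The variety of `n`-dimensional real Lie algebra laws, in terms of structure constants
`[X_i, X_j] = ∑ c i j k X_k`; it carries the topology of `ℝ^(n³)`. -/
def lieLaws (n : ℕ) : Set (Fin n → Fin n → Fin n → ℝ) :=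
  {c | (∀ i j k, c i j k = - c j i k) ∧
    ∀ i j k m, ∑ l, (c i j l * c l k m + c j k l * c l i m + c k i l * c l j m) = 0}

/-- The structure constants of a Lie algebra with respect to a basis. -/
noncomputable def structureConstants {L : Type u} [LieRing L] [LieAlgebra ℝ L] {n : ℕ}
    (X : Module.Basis (Fin n) ℝ L) : Fin n → Fin n → Fin n → ℝ :=
  fun i j k => X.repr ⁅X i, X j⁆ k

/-- The laws that define a Lie algebra isomorphic to `L`. This is the `GL(n, ℝ)`-orbit of the law
of `L`: the structure constants of `L` with respect to all of its bases. -/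
def lieOrbit (L : Type u) [LieRing L] [LieAlgebra ℝ L] (n : ℕ) :
    Set (Fin n → Fin n → Fin n → ℝ) :=
  Set.range fun X : Module.Basis (Fin n) ℝ L => structureConstants X

/-- A finite-dimensional real Lie algebra is rigid (stable) if its orbit is open in the variety
of Lie algebra laws: all nearby Lie algebra laws are isomorphic to it. -/
def IsRigidLie (L : Type u) [LieRing L] [LieAlgebra ℝ L] : Prop :=
  IsOpen ((↑) ⁻¹' lieOrbit L (Module.finrank ℝ L) : Set (lieLaws (Module.finrank ℝ L)))

/-- The Lie algebra `H` contracts onto `L`: there are invertible linear maps `Φ t` of `H` such that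
`Φ t⁻¹ [Φ t x, Φ t y]` converges for `t → ∞`, and `H` with the limit as bracket is isomorphic
to `L`. -/
def ContractsOnto (H : Type u) [LieRing H] [LieAlgebra ℝ H] [TopologicalSpace H]
    (L : Type v) [LieRing L] [LieAlgebra ℝ L] : Prop :=
  ∃ (Φ : ℝ → H ≃ₗ[ℝ] H) (e : H ≃ₗ[ℝ] L), ∀ x y : H,
    Tendsto (fun t => (Φ t).symm ⁅Φ t x, Φ t y⁆) atTop (𝓝 (e.symm ⁅e x, e y⁆))

end General

/-! ### The ten-dimensional Lie algebra -/

/-- The ten-dimensional real Lie algebra; `x i` is the coefficient of the basis vector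
`X_{i+1}`. -/
def G10 : Type := Fin 10 → ℝ

namespace G10

noncomputable instance : AddCommGroup G10 := inferInstanceAs (AddCommGroup (Fin 10 → ℝ))

noncomputable instance : Module ℝ G10 := inferInstanceAs (Module ℝ (Fin 10 → ℝ))

/-- The 2×2 minor `x_{i+1} y_{j+1} - x_{j+1} y_{i+1}`. -/
noncomputable def minor (x y : Fin 10 → ℝ) (i j : Fin 10) : ℝ := x i * y j - x j * y i

/-- The element with the given coordinates. -/
def mk (x : Fin 10 → ℝ) : G10 := x

@[simp] theorem mk_apply (x : Fin 10 → ℝ) (i : Fin 10) : mk x i = x i := rfl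

/-- The bracket in coordinates; the values on the basis vectors are `bracket_basis` below. -/
noncomputable instance : Bracket G10 G10 where
  bracket x y :=
    mk ![minor x y 1 2,
       2 * minor x y 0 1,
       -2 * minor x y 0 2,
       minor x y 0 3 + minor x y 1 4,
       -minor x y 0 4 + minor x y 2 3,
       minor x y 0 5 + minor x y 1 6,
       -minor x y 0 6 + minor x y 2 5,
       2 * minor x y 0 7 + 2 * minor x y 1 8 + 2 * minor x y 3 5,
       minor x y 1 9 + minor x y 2 7 + minor x y 3 6 + minor x y 4 5,
       -2 * minor x y 0 9 + 2 * minor x y 2 8 + 2 * minor x y 4 6]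

theorem bracket_def (x y : G10) : ⁅x, y⁆ =
    mk ![minor x y 1 2,
       2 * minor x y 0 1,
       -2 * minor x y 0 2,
       minor x y 0 3 + minor x y 1 4,
       -minor x y 0 4 + minor x y 2 3,
       minor x y 0 5 + minor x y 1 6,
       -minor x y 0 6 + minor x y 2 5,
       2 * minor x y 0 7 + 2 * minor x y 1 8 + 2 * minor x y 3 5,
       minor x y 1 9 + minor x y 2 7 + minor x y 3 6 + minor x y 4 5,
       -2 * minor x y 0 9 + 2 * minor x y 2 8 + 2 * minor x y 4 6] := rfl

@[simp] theorem add_apply (x y : G10) (i : Fin 10) : (x + y) i = x i + y i := rfl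

@[simp] theorem smul_apply (t : ℝ) (x : G10) (i : Fin 10) : (t • x) i = t * x i := rfl

@[simp] theorem neg_apply (x : G10) (i : Fin 10) : (-x) i = -x i := rfl

@[simp] theorem zero_apply (i : Fin 10) : (0 : G10) i = 0 := rfl

@[ext] theorem ext {x y : G10} (h : ∀ i, x i = y i) : x = y := funext h

noncomputable instance : LieRing G10 where
  add_lie x y z := by
    ext i
    fin_cases i <;> simp [bracket_def, minor] <;> ring
  lie_add x y z := by
    ext i
    fin_cases i <;> simp [bracket_def, minor] <;> ring
  lie_self x := by
    ext i
    fin_cases i <;> simp [bracket_def, minor] <;> ring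
  leibniz_lie x y z := by
    ext i
    fin_cases i <;> simp [bracket_def, minor] <;> ring

noncomputable instance : LieAlgebra ℝ G10 where
  lie_smul t x y := by
    ext i
    fin_cases i <;> simp [bracket_def, minor] <;> ring

/-- The standard basis: `X i` is the basis vector `X_{i+1}`. -/
noncomputable def X : Module.Basis (Fin 10) ℝ G10 := Pi.basisFun ℝ (Fin 10)

theorem X_apply (i j : Fin 10) : X i j = if j = i then 1 else 0 := by
  change Pi.basisFun ℝ (Fin 10) i j = _
  simp [Pi.single_apply]

set_option maxHeartbeats 4000000 in
/-- The table of all non-zero brackets of basis vectors. -/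
theorem bracket_basis :
    ⁅X 0, X 1⁆ = (2 : ℝ) • X 1 ∧ ⁅X 0, X 2⁆ = (-2 : ℝ) • X 2 ∧ ⁅X 1, X 2⁆ = X 0 ∧
    ⁅X 0, X 3⁆ = X 3 ∧ ⁅X 0, X 4⁆ = -X 4 ∧ ⁅X 0, X 5⁆ = X 5 ∧ ⁅X 0, X 6⁆ = -X 6 ∧
    ⁅X 0, X 7⁆ = (2 : ℝ) • X 7 ∧ ⁅X 0, X 9⁆ = (-2 : ℝ) • X 9 ∧ ⁅X 1, X 4⁆ = X 3 ∧
    ⁅X 1, X 6⁆ = X 5 ∧ ⁅X 1, X 8⁆ = (2 : ℝ) • X 7 ∧ ⁅X 1, X 9⁆ = X 8 ∧ ⁅X 2, X 3⁆ = X 4 ∧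
    ⁅X 2, X 5⁆ = X 6 ∧ ⁅X 2, X 7⁆ = X 8 ∧ ⁅X 2, X 8⁆ = (2 : ℝ) • X 9 ∧
    ⁅X 3, X 5⁆ = (2 : ℝ) • X 7 ∧ ⁅X 3, X 6⁆ = X 8 ∧ ⁅X 4, X 5⁆ = X 8 ∧
    ⁅X 4, X 6⁆ = (2 : ℝ) • X 9 ∧
    ∀ i j : Fin 10, i < j →
      (i, j) ∉ ([(0, 1), (0, 2), (1, 2), (0, 3), (0, 4), (0, 5), (0, 6), (0, 7), (0, 9), (1, 4),
        (1, 6), (1, 8), (1, 9), (2, 3), (2, 5), (2, 7), (2, 8), (3, 5), (3, 6), (4, 5),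
        (4, 6)] : List (Fin 10 × Fin 10)) → ⁅X i, X j⁆ = 0 := by
  refine ⟨?_, ?_, ?_, ?_, ?_, ?_, ?_, ?_, ?_, ?_, ?_, ?_, ?_, ?_, ?_, ?_, ?_, ?_, ?_, ?_, ?_, ?_⟩
  case refine_22 =>
    intro i j hij hl
    have hm : ∀ k l : Fin 10, (k, l) ∈ ([(0, 1), (0, 2), (1, 2), (0, 3), (0, 4), (0, 5), (0, 6),
        (0, 7), (0, 9), (1, 4), (1, 6), (1, 8), (1, 9), (2, 3), (2, 5), (2, 7), (2, 8), (3, 5),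
        (3, 6), (4, 5), (4, 6)] : List (Fin 10 × Fin 10)) → minor (X i) (X j) k l = 0 := by
      intro k l hkl
      have hkl' : k < l := by
        revert hkl
        revert k l
        decide
      have h1 : ¬ (k = i ∧ l = j) := by
        rintro ⟨rfl, rfl⟩
        exact hl hkl
      have h2 : ¬ (l = i ∧ k = j) := by
        rintro ⟨rfl, rfl⟩
        exact absurd hij (not_lt.2 hkl'.le)
      simp only [minor, X_apply]
      grind
    rw [bracket_def]
    ext k
    fin_cases k <;> simp [hm]
  all_goals
    ext k
    fin_cases k <;> simp [bracket_def, minor, X_apply]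

/-- The quadratic polynomial `x₁x₉ + 2(x₂x₁₀ - x₃x₈) + x₄x₇ - x₅x₆`; the variable `x_{i+1}` is
`MvPolynomial.X i`. -/
noncomputable def casimirPolynomial : MvPolynomial (Fin 10) ℝ :=
  let x : Fin 10 → MvPolynomial (Fin 10) ℝ := MvPolynomial.X
  x 0 * x 8 + 2 * (x 1 * x 9 - x 2 * x 7) + x 3 * x 6 - x 4 * x 5

end G10

/-!
The proof has three parts: the structure of `G10`, the vanishing of its second adjoint cohomology,
and a general theorem that turns the latter into rigidity.

*Structure.* An ideal that is not contained in the span `nilIdeal` of `X 3, …, X 9` contains, after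
bracketing with `X 1` and `X 2`, an element congruent to a non-zero multiple of `X 1`, and so does
its derived ideal; hence it is not solvable, and `nilIdeal` is the radical. The invariant form
`G10.form` pairs `X i` with `X (dual i)`; the Casimir operator is the one attached to this form, and
its commutators cancel in pairs by invariance. In a reductive Lie algebra every abelian ideal is
central, which fails for the span of `X 7, X 8, X 9`.

*Cohomology.* Only two inequalities are needed. A derivation with fourteen suitable coordinates
equal to zero vanishes (`G10.derivation_eq_zero`), so `dim B² ≥ 100 - 14`; a cocycle with eighty-six
suitable coordinates equal to zero vanishes (`G10.cocycle_eq_zero`), so `dim Z² ≤ 86`. As `B² ⊆ Z²`,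
both spaces have dimension 86. For the second inequality, 72 of the coordinates are the entries of
`φ (X 0, ·)` that do not preserve the weights of `ad (X 0)`. If they are zero, `φ (X 0, ·)`
preserves weights, and the cocycle identity with `X 0` as one argument shows that `φ` has weight
zero. This leaves 70 coordinates, to which the remaining 14 conditions and the equations of weight
zero apply; a second grading splits these equations into small systems.

*Rigidity.* `isRigidLie_of_subsingleton_adjointH2` is the theorem of Nijenhuis and Richardson. With
a complement `W` of the coboundaries in the space of all structure constants, the map
`(g, w) ↦ g • (c + w)` is a submersion at `(1, 0)`, where `c` is the law of the Lie algebra. A law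
near `c` is therefore of the form `g • (c + w)` with small `w ∈ W`, and `c + w` is a law as well. Its Jacobi
identity says that the linear map `cocycleCoord c`, which is injective on the alternating elements
of `W` because every cocycle is a coboundary, takes at `w` a value that is quadratic in `w`; so
`w = 0`. If `H` contracts onto a rigid `L`, then the structure constants of `H` in suitable bases
converge to those of `L` and end up in its orbit, whence `H` is isomorphic to `L`.
-/

/-! ### Abelian ideals of reductive Lie algebras -/

section Reductive

variable {L : Type*} [LieRing L] [LieAlgebra ℝ L]

/-- In a reductive Lie algebra every abelian ideal is central: it meets the semisimple ideal in an
abelian ideal of the latter, that is, in zero. -/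
theorem IsReductiveLie.lie_eq_zero_of_mem_abelian_ideal (h : IsReductiveLie L) (I : LieIdeal ℝ L)
    (hI : ∀ x ∈ I, ∀ y ∈ I, ⁅x, y⁆ = 0) {x : L} (hx : x ∈ I) (y : L) : ⁅x, y⁆ = 0 := by
  obtain ⟨S, A, hSA, hS, hA⟩ := h
  have hIS : ∀ z ∈ I, z ∈ S → z = 0 := by
    intro z hz hzS
    have hab : IsLieAbelian (I.comap S.incl) := by
      refine ⟨fun a b => ?_⟩
      have ha := LieIdeal.mem_comap.1 a.2
      have hb := LieIdeal.mem_comap.1 b.2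
      apply Subtype.ext
      apply Subtype.ext
      exact hI _ ha _ hb
    have hle : I.comap S.incl ≤ LieAlgebra.radical ℝ S :=
      le_sSup (LieAlgebra.ofAbelianIsSolvable (L := I.comap S.incl))
    rw [hS.radical_eq_bot] at hle
    have h0 : (⟨z, hzS⟩ : S) ∈ I.comap S.incl := LieIdeal.mem_comap.2 hz
    simpa using hle h0
  have hdisj : ∀ z ∈ S, z ∈ A → z = 0 := by
    intro z hz hz'
    have : z ∈ S ⊓ A := ⟨hz, hz'⟩
    rwa [hSA.inf_eq_bot, LieSubmodule.mem_bot] at this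
  have hsum : ∀ z : L, ∃ s ∈ S, ∃ a ∈ A, s + a = z := by
    intro z
    have : z ∈ S ⊔ A := by rw [hSA.sup_eq_top]; exact LieSubmodule.mem_top z
    exact (LieSubmodule.mem_sup S A z).1 this
  have hcomm : ∀ s ∈ S, ⁅x, s⁆ = 0 := fun s hs =>
    hIS _ (lie_mem_left ℝ L I x s hx) (lie_mem_right ℝ L S x s hs)
  obtain ⟨s, hs, a, ha, rfl⟩ := hsum y
  obtain ⟨s', hs', a', ha', rfl⟩ := hsum x
  have h1 : ⁅s', a⁆ = 0 :=
    hdisj _ (lie_mem_left ℝ L S s' a hs') (lie_mem_right ℝ L A s' a ha)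
  have h2 : ⁅a', a⁆ = 0 := by
    have := hA.trivial ⟨a', ha'⟩ ⟨a, ha⟩
    exact congrArg Subtype.val this
  rw [lie_add, hcomm s hs, add_lie, h1, h2]
  simp

end Reductive

/-! ### Bilinear products in coordinates -/

section Coordinates

variable {V : Type*} [AddCommGroup V] [Module ℝ V] {n : ℕ}

/-- The bilinear product on `V` whose structure constants with respect to the basis `X` are `c`. -/
noncomputable def productOf (X : Module.Basis (Fin n) ℝ V) (c : Fin n → Fin n → Fin n → ℝ) :
    V →ₗ[ℝ] V →ₗ[ℝ] V :=
  X.constr ℝ fun i => X.constr ℝ fun j => ∑ k, c i j k • X k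

@[simp] theorem productOf_basis (X : Module.Basis (Fin n) ℝ V) (c : Fin n → Fin n → Fin n → ℝ)
    (i j : Fin n) : productOf X c (X i) (X j) = ∑ k, c i j k • X k := by
  simp [productOf]

theorem repr_sum_smul_basis (X : Module.Basis (Fin n) ℝ V) (a : Fin n → ℝ) (k : Fin n) :
    X.repr (∑ l, a l • X l) k = a k := by
  rw [← X.equivFun_apply, ← X.equivFun_symm_apply, LinearEquiv.apply_symm_apply]

theorem eq_productOf (X : Module.Basis (Fin n) ℝ V) (c : Fin n → Fin n → Fin n → ℝ)
    (φ : V →ₗ[ℝ] V →ₗ[ℝ] V) (h : ∀ i j, φ (X i) (X j) = ∑ k, c i j k • X k) :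
    φ = productOf X c :=
  X.ext fun i => X.ext fun j => by rw [h, productOf_basis]

/-- The trilinear map `(x, y, z) ↦ ψ (φ x y) z + ψ (φ y z) x + ψ (φ z x) y`. -/
def jacobiMap (φ ψ : V →ₗ[ℝ] V →ₗ[ℝ] V) : V →ₗ[ℝ] V →ₗ[ℝ] V →ₗ[ℝ] V where
  toFun x := {
    toFun y := {
      toFun z := ψ (φ x y) z + ψ (φ y z) x + ψ (φ z x) y
      map_add' _ _ := by simp; abel
      map_smul' _ _ := by simp }
    map_add' _ _ := by ext; simp; abel
    map_smul' _ _ := by ext; simp }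
  map_add' _ _ := by ext; simp; abel
  map_smul' _ _ := by ext; simp

theorem jacobiMap_apply (φ ψ : V →ₗ[ℝ] V →ₗ[ℝ] V) (x y z : V) :
    jacobiMap φ ψ x y z = ψ (φ x y) z + ψ (φ y z) x + ψ (φ z x) y := rfl

/-- The coordinates of `jacobiMap`. -/
def jacobiCoord (c d : Fin n → Fin n → Fin n → ℝ) : Fin n → Fin n → Fin n → Fin n → ℝ :=
  fun i j k m => ∑ l, (c i j l * d l k m + c j k l * d l i m + c k i l * d l j m)

theorem jacobiMap_productOf_basis (X : Module.Basis (Fin n) ℝ V)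
    (c d : Fin n → Fin n → Fin n → ℝ) (i j k : Fin n) :
    jacobiMap (productOf X c) (productOf X d) (X i) (X j) (X k) =
      ∑ m, jacobiCoord c d i j k m • X m := by
  have h : ∀ a b e : Fin n, productOf X d (productOf X c (X a) (X b)) (X e) =
      ∑ m, (∑ l, c a b l * d l e m) • X m := by
    intro a b e
    simp only [productOf_basis, map_sum, map_smul, LinearMap.sum_apply, LinearMap.smul_apply,
      Finset.smul_sum, smul_smul, Finset.sum_smul]
    rw [Finset.sum_comm]
  simp only [jacobiMap_apply, h, jacobiCoord, Finset.sum_add_distrib, add_smul]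

theorem productOf_self_iff (X : Module.Basis (Fin n) ℝ V) (c : Fin n → Fin n → Fin n → ℝ) :
    (∀ x, productOf X c x x = 0) ↔ ∀ i j k, c i j k = - c j i k := by
  constructor
  · intro h i j k
    have h1 := h (X i + X j)
    simp only [map_add, LinearMap.add_apply, h, zero_add, add_zero] at h1
    have h2 := congrArg (fun v => X.repr v k) h1
    simp only [productOf_basis, map_add, Finsupp.add_apply, repr_sum_smul_basis, map_zero,
      Finsupp.zero_apply] at h2
    linarith
  · intro h x
    have h1 : productOf X c = -(productOf X c).flip := by
      refine X.ext fun i => X.ext fun j => ?_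
      simp only [LinearMap.neg_apply, LinearMap.flip_apply, productOf_basis]
      rw [← Finset.sum_neg_distrib]
      refine Finset.sum_congr rfl fun k _ => ?_
      rw [h i j k, neg_smul]
    have h2 := LinearMap.congr_fun₂ h1 x x
    simp only [LinearMap.neg_apply, LinearMap.flip_apply] at h2
    have h3 : (2 : ℝ) • productOf X c x x = 0 := by
      rw [two_smul, ← eq_neg_iff_add_eq_zero]
      exact h2
    exact (smul_eq_zero.1 h3).resolve_left two_ne_zero

theorem mem_lieLaws_iff (X : Module.Basis (Fin n) ℝ V) (c : Fin n → Fin n → Fin n → ℝ) :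
    c ∈ lieLaws n ↔ (∀ x, productOf X c x x = 0) ∧
      jacobiMap (productOf X c) (productOf X c) = 0 := by
  rw [productOf_self_iff]
  refine and_congr Iff.rfl ⟨fun h => ?_, fun h i j k m => ?_⟩
  · refine X.ext fun i => X.ext fun j => X.ext fun k => ?_
    rw [jacobiMap_productOf_basis]
    simp [jacobiCoord, h]
  · have h1 := jacobiMap_productOf_basis X c c i j k
    have h2 := congrArg (fun v => X.repr v m) h1
    simp only [repr_sum_smul_basis, h] at h2
    simpa [jacobiCoord] using h2.symm

/-- The basis whose elements have the rows of an invertible matrix as coordinates. -/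
noncomputable def rowBasis (X : Module.Basis (Fin n) ℝ V) (g : Matrix (Fin n) (Fin n) ℝ)
    (hg : IsUnit g.det) : Module.Basis (Fin n) ℝ V :=
  X.map (Matrix.toLinearEquiv X g.transpose (by rwa [Matrix.det_transpose]))

theorem rowBasis_apply (X : Module.Basis (Fin n) ℝ V) (g : Matrix (Fin n) (Fin n) ℝ)
    (hg : IsUnit g.det) (i : Fin n) : rowBasis X g hg i = ∑ a, g i a • X a := by
  simp only [rowBasis, Module.Basis.map_apply]
  change Matrix.toLin X X g.transpose (X i) = _
  simp [Matrix.toLin_self]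

/-- The relation between the structure constants of one product in two bases, in a form without
inverse matrices: if it holds, then `c` and `d` define the same product. -/
theorem productOf_eq_productOf_rowBasis (X : Module.Basis (Fin n) ℝ V)
    (c d : Fin n → Fin n → Fin n → ℝ) (g : Matrix (Fin n) (Fin n) ℝ) (hg : IsUnit g.det)
    (h : ∀ i j k, ∑ a, ∑ b, g i a * g j b * c a b k = ∑ l, d i j l * g l k) :
    productOf X c = productOf (rowBasis X g hg) d := by
  refine eq_productOf _ _ _ fun i j => ?_
  simp only [rowBasis_apply, map_sum, map_smul, LinearMap.sum_apply, LinearMap.smul_apply,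
    productOf_basis, Finset.smul_sum, smul_smul]
  have h1 : ∀ k, (∑ a, ∑ b, g i a * g j b * c a b k) • X k = (∑ l, d i j l * g l k) • X k :=
    fun k => by rw [h]
  simp only [Finset.sum_smul] at h1
  have h2 := Finset.sum_congr (rfl : (Finset.univ : Finset (Fin n)) = Finset.univ)
    fun k _ => h1 k
  rw [Finset.sum_comm (f := fun x y => (d i j x * g x y) • X y), ← h2, Finset.sum_comm]
  refine (Finset.sum_congr rfl fun b _ => Finset.sum_comm).trans ?_
  rw [Finset.sum_comm]
  refine Finset.sum_congr rfl fun a _ => Finset.sum_congr rfl fun b _ =>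
    Finset.sum_congr rfl fun k _ => ?_
  congr 1
  ring

variable {L : Type*} [LieRing L] [LieAlgebra ℝ L]

theorem productOf_structureConstants (X : Module.Basis (Fin n) ℝ L) (x y : L) :
    productOf X (structureConstants X) x y = ⁅x, y⁆ := by
  have h : (LieModule.toEnd ℝ L L : L →ₗ[ℝ] L →ₗ[ℝ] L) = productOf X (structureConstants X) :=
    eq_productOf X _ _ fun i j => (X.sum_repr ⁅X i, X j⁆).symm
  exact (LinearMap.congr_fun₂ h x y).symm

theorem structureConstants_mem_lieLaws (X : Module.Basis (Fin n) ℝ L) :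
    structureConstants X ∈ lieLaws n := by
  rw [mem_lieLaws_iff X]
  refine ⟨fun x => by rw [productOf_structureConstants, lie_self], ?_⟩
  ext x y z
  simp only [jacobiMap_apply, productOf_structureConstants, LinearMap.zero_apply]
  have := lie_jacobi x y z
  rw [← lie_skew ⁅x, y⁆ z, ← lie_skew ⁅y, z⁆ x, ← lie_skew ⁅z, x⁆ y, ← neg_add, ← neg_add,
    neg_eq_zero, ← this]
  abel

/-- If `d` is a change of basis of the structure constants of `L`, then it lies in the orbit. -/
theorem mem_lieOrbit_of_transform (X : Module.Basis (Fin n) ℝ L)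
    (d : Fin n → Fin n → Fin n → ℝ) (g : Matrix (Fin n) (Fin n) ℝ) (hg : IsUnit g.det)
    (h : ∀ i j k, ∑ a, ∑ b, g i a * g j b * structureConstants X a b k = ∑ l, d i j l * g l k) :
    d ∈ lieOrbit L n := by
  refine ⟨rowBasis X g hg, ?_⟩
  have h1 := productOf_eq_productOf_rowBasis X _ d g hg h
  funext i j k
  dsimp only [structureConstants]
  rw [← productOf_structureConstants X, h1, productOf_basis, repr_sum_smul_basis]

theorem mem_lieLaws_of_transform {c d : Fin n → Fin n → Fin n → ℝ}
    (g : Matrix (Fin n) (Fin n) ℝ) (hg : IsUnit g.det)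
    (h : ∀ i j k, ∑ a, ∑ b, g i a * g j b * c a b k = ∑ l, d i j l * g l k)
    (hd : d ∈ lieLaws n) : c ∈ lieLaws n := by
  have X := Pi.basisFun ℝ (Fin n)
  rw [mem_lieLaws_iff (rowBasis X g hg), ← productOf_eq_productOf_rowBasis X c d g hg h] at hd
  exact (mem_lieLaws_iff X c).2 hd

end Coordinates

/-! ### The theorem of Nijenhuis and Richardson -/

section Rigidity

variable {n : ℕ}

/-- The difference of the two sides of the relation `[Y i, Y j] = ∑ l, d i j l • Y l` between the
structure constants `c` in a basis `X` and `d` in the basis `Y i = ∑ a, g i a • X a`. -/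
def transformDefect (g : Fin n → Fin n → ℝ) (c d : Fin n → Fin n → Fin n → ℝ) :
    Fin n → Fin n → Fin n → ℝ :=
  fun i j k => ∑ a, ∑ b, g i a * g j b * c a b k - ∑ l, d i j l * g l k

/-- The coboundary operator in coordinates: the derivative of the action of the general linear
group on structure constants. -/
def coboundaryCoord (c : Fin n → Fin n → Fin n → ℝ) :
    (Fin n → Fin n → ℝ) →ₗ[ℝ] (Fin n → Fin n → Fin n → ℝ) where
  toFun A := fun i j k =>
    ∑ a, A i a * c a j k + ∑ b, A j b * c i b k - ∑ l, c i j l * A l k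
  map_add' A B := by
    funext i j k
    simp only [Pi.add_apply, add_mul, mul_add, Finset.sum_add_distrib]
    ring
  map_smul' t A := by
    funext i j k
    simp only [Pi.smul_apply, smul_eq_mul, RingHom.id_apply, mul_sub, mul_add, Finset.mul_sum,
      mul_assoc, mul_left_comm _ t]

theorem coboundaryCoord_apply (c : Fin n → Fin n → Fin n → ℝ) (A : Fin n → Fin n → ℝ)
    (i j k : Fin n) : coboundaryCoord c A i j k =
      ∑ a, A i a * c a j k + ∑ b, A j b * c i b k - ∑ l, c i j l * A l k := rfl

theorem contDiff_transformDefect :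
    ContDiff ℝ 1 fun p : (Fin n → Fin n → ℝ) × (Fin n → Fin n → Fin n → ℝ) ×
      (Fin n → Fin n → Fin n → ℝ) => transformDefect p.1 p.2.1 p.2.2 := by
  unfold transformDefect
  fun_prop

theorem hasDerivAt_transformDefect (c : Fin n → Fin n → Fin n → ℝ) (A : Fin n → Fin n → ℝ)
    (u v : Fin n → Fin n → Fin n → ℝ) :
    HasDerivAt (fun t : ℝ => transformDefect ((fun i => Pi.single i 1) + t • A)
      (c + t • u) (c + t • v)) (coboundaryCoord c A + u - v) 0 := by
  have aff : ∀ a b : ℝ, HasDerivAt (fun t : ℝ => a + t * b) b 0 := fun a b => by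
    simpa using ((hasDerivAt_id (0 : ℝ)).mul_const b).const_add a
  refine hasDerivAt_pi.2 fun i => hasDerivAt_pi.2 fun j => hasDerivAt_pi.2 fun k => ?_
  have h1 := (HasDerivAt.fun_sum (u := Finset.univ) fun a _ =>
    HasDerivAt.fun_sum (u := Finset.univ) fun b _ =>
      ((aff ((Pi.single i 1 : Fin n → ℝ) a) (A i a)).fun_mul
        (aff ((Pi.single j 1 : Fin n → ℝ) b) (A j b))).fun_mul
        (aff (c a b k) (u a b k))).fun_sub
    (HasDerivAt.fun_sum (u := Finset.univ) fun l _ =>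
      (aff (c i j l) (v i j l)).fun_mul (aff ((Pi.single l 1 : Fin n → ℝ) k) (A l k)))
  refine h1.congr_deriv ?_
  simp [coboundaryCoord_apply, Pi.single_apply, add_mul, Finset.sum_add_distrib]
  ring

/-- The linear part of `w ↦ jacobiCoord (c + w) (c + w)`. -/
def cocycleCoord (c : Fin n → Fin n → Fin n → ℝ) :
    (Fin n → Fin n → Fin n → ℝ) →ₗ[ℝ] (Fin n → Fin n → Fin n → Fin n → ℝ) where
  toFun w := jacobiCoord c w + jacobiCoord w c
  map_add' v w := by
    funext i j k m
    simp only [jacobiCoord, Pi.add_apply, ← Finset.sum_add_distrib]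
    exact Finset.sum_congr rfl fun l _ => by ring
  map_smul' t w := by
    funext i j k m
    simp only [jacobiCoord, Pi.add_apply, Pi.smul_apply, smul_eq_mul, RingHom.id_apply,
      ← Finset.sum_add_distrib, Finset.mul_sum]
    exact Finset.sum_congr rfl fun l _ => by ring

theorem cocycleCoord_apply (c w : Fin n → Fin n → Fin n → ℝ) :
    cocycleCoord c w = jacobiCoord c w + jacobiCoord w c := rfl

theorem jacobiCoord_add_self (c w : Fin n → Fin n → Fin n → ℝ) :
    jacobiCoord (c + w) (c + w) = jacobiCoord c c + cocycleCoord c w + jacobiCoord w w := by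
  funext i j k m
  simp only [cocycleCoord_apply, jacobiCoord, Pi.add_apply, ← Finset.sum_add_distrib]
  exact Finset.sum_congr rfl fun l _ => by ring

theorem norm_jacobiCoord_self_le (w : Fin n → Fin n → Fin n → ℝ) :
    ‖jacobiCoord w w‖ ≤ 3 * n * ‖w‖ ^ 2 := by
  have hw : ∀ i j k, |w i j k| ≤ ‖w‖ := fun i j k =>
    (norm_le_pi_norm (w i j) k).trans ((norm_le_pi_norm (w i) j).trans (norm_le_pi_norm w i))
  have hp : ∀ i j k l m p, |w i j k * w l m p| ≤ ‖w‖ ^ 2 := fun i j k l m p => by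
    rw [abs_mul, sq]
    exact mul_le_mul (hw _ _ _) (hw _ _ _) (abs_nonneg _) (norm_nonneg _)
  have h0 : 0 ≤ 3 * (n : ℝ) * ‖w‖ ^ 2 := by positivity
  refine (pi_norm_le_iff_of_nonneg h0).2 fun i => (pi_norm_le_iff_of_nonneg h0).2 fun j =>
    (pi_norm_le_iff_of_nonneg h0).2 fun k => (pi_norm_le_iff_of_nonneg h0).2 fun m => ?_
  rw [Real.norm_eq_abs, jacobiCoord]
  refine (Finset.abs_sum_le_sum_abs _ _).trans ?_
  refine (Finset.sum_le_card_nsmul _ _ (3 * ‖w‖ ^ 2) fun l _ => ?_).trans ?_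
  · refine (abs_add_three _ _ _).trans ?_
    linarith [hp i j l l k m, hp j k l l i m, hp k i l l j m]
  · simp only [Finset.card_univ, Fintype.card_fin, nsmul_eq_mul]
    linarith

/-- On a subspace that contains no non-zero cocycle, the equation of the laws near `c` has only the
trivial small solution: its linear part dominates the quadratic one. -/
theorem exists_pos_forall_eq_zero_of_jacobi (c : Fin n → Fin n → Fin n → ℝ)
    (W : Submodule ℝ (Fin n → Fin n → Fin n → ℝ))
    (hW : ∀ w ∈ W, cocycleCoord c w = 0 → w = 0) :
    ∃ ε > 0, ∀ w ∈ W, ‖w‖ < ε → cocycleCoord c w + jacobiCoord w w = 0 → w = 0 := by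
  have hker : LinearMap.ker ((cocycleCoord c).domRestrict W) = ⊥ := by
    rw [LinearMap.ker_eq_bot']
    exact fun w hw => Subtype.ext (hW w w.2 hw)
  obtain ⟨K, hK, hanti⟩ := ((cocycleCoord c).domRestrict W).exists_antilipschitzWith hker
  have hK' : (0 : ℝ) < K := hK
  have hpos : 0 < (K : ℝ) * (3 * n + 1) := by positivity
  refine ⟨((K : ℝ) * (3 * n + 1))⁻¹, by positivity, fun w hw hlt h => ?_⟩
  by_contra hne
  have hn : 0 < ‖w‖ := norm_pos_iff.2 hne
  have h1 : ‖w‖ ≤ K * ‖cocycleCoord c w‖ := by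
    have := hanti.le_mul_dist ⟨w, hw⟩ 0
    simpa [dist_eq_norm] using this
  have h2 : ‖cocycleCoord c w‖ ≤ 3 * n * ‖w‖ ^ 2 := by
    rw [eq_neg_of_add_eq_zero_left h, norm_neg]
    exact norm_jacobiCoord_self_le w
  have h3 : (K : ℝ) * (3 * n + 1) * ‖w‖ < 1 := by
    rw [lt_inv_comm₀ hn hpos] at hlt
    calc _ < ‖w‖⁻¹ * ‖w‖ := by gcongr
      _ = 1 := inv_mul_cancel₀ hn.ne'
  have h4 : ‖w‖ * 1 ≤ ‖w‖ * (K * (3 * n) * ‖w‖) :=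
    calc ‖w‖ * 1 ≤ K * ‖cocycleCoord c w‖ := by linarith
      _ ≤ K * (3 * n * ‖w‖ ^ 2) := by gcongr
      _ = _ := by ring
  have h5 := le_of_mul_le_mul_left h4 hn
  have h6 : 0 < (K : ℝ) * ‖w‖ := by positivity
  linarith

variable {L : Type*} [LieRing L] [LieAlgebra ℝ L]

/-- If all infinitesimal deformations of the law of `L` are coboundaries, then every law near that
of `L` lies in its orbit. With a complement `W` of the coboundaries, the submersion theorem solves
`d = g • (c + w)` for every `d` near `c`, with `g` near `1` and `w ∈ W` near `0`; when `d` is a Lie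
law, so is `c + w`, which forces `w = 0`. The relation `d = g • (c + w)` is written with
`transformDefect`, which keeps it polynomial. -/
theorem eventually_mem_lieOrbit (X : Module.Basis (Fin n) ℝ L)
    (hX : ∀ w : Fin n → Fin n → Fin n → ℝ, (∀ i j k, w i j k = - w j i k) →
      cocycleCoord (structureConstants X) w = 0 →
      w ∈ LinearMap.range (coboundaryCoord (structureConstants X))) :
    ∀ᶠ d in 𝓝 (structureConstants X), d ∈ lieLaws n → d ∈ lieOrbit L n := by
  have hc := structureConstants_mem_lieLaws X
  have horb := mem_lieOrbit_of_transform X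
  generalize structureConstants X = c at *
  obtain ⟨W, hW⟩ := (LinearMap.range (coboundaryCoord c)).exists_isCompl
  let alt : Submodule ℝ (Fin n → Fin n → Fin n → ℝ) :=
    { carrier := {w | ∀ i j k, w i j k = - w j i k}
      add_mem' := fun {v w} hv hw i j k => by
        simp only [Pi.add_apply]; rw [hv i j k, hw i j k]; ring
      zero_mem' := fun i j k => by simp
      smul_mem' := fun t w hw i j k => by
        simp only [Pi.smul_apply, smul_eq_mul]; rw [hw i j k]; ring }
  -- The only law `c + w` with small `w ∈ W` is `c` itself.
  obtain ⟨ε, hε, hsmall⟩ := exists_pos_forall_eq_zero_of_jacobi c (W ⊓ alt) fun w hw h =>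
    Submodule.disjoint_def.1 hW.disjoint w (hX w hw.2 h) hw.1
  -- Carrying `d` along as a second component turns the implicit equation for `(g, w)` into the
  -- statement that `F` is open at the base point.
  let F : (Fin n → Fin n → ℝ) × W × (Fin n → Fin n → Fin n → ℝ) →
      (Fin n → Fin n → Fin n → ℝ) × (Fin n → Fin n → Fin n → ℝ) :=
    fun p => (transformDefect p.1 (c + p.2.1) p.2.2, p.2.2)
  let one : Fin n → Fin n → ℝ := fun i => Pi.single i 1
  have hF : ContDiff ℝ 1 F := by
    refine ContDiff.prodMk (contDiff_transformDefect.comp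
      (g := fun p : (Fin n → Fin n → ℝ) × (Fin n → Fin n → Fin n → ℝ) ×
        (Fin n → Fin n → Fin n → ℝ) => transformDefect p.1 p.2.1 p.2.2)
      (f := fun p : (Fin n → Fin n → ℝ) × W × (Fin n → Fin n → Fin n → ℝ) =>
        (p.1, c + (p.2.1 : Fin n → Fin n → Fin n → ℝ), p.2.2)) ?_) (by fun_prop)
    refine contDiff_fst.prodMk (ContDiff.prodMk (contDiff_const.add ?_) (by fun_prop))
    exact W.subtypeL.contDiff.comp (by fun_prop)
  have hstrict : HasStrictFDerivAt F (fderiv ℝ F (one, 0, c)) (one, 0, c) :=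
    hF.contDiffAt.hasStrictFDerivAt one_ne_zero
  have hderiv : ∀ (A : Fin n → Fin n → ℝ) (w : W) (v : Fin n → Fin n → Fin n → ℝ),
      fderiv ℝ F (one, 0, c) (A, w, v) = (coboundaryCoord c A + w - v, v) := by
    intro A w v
    have hline : HasDerivAt (fun t : ℝ => ((one, 0, c) : _ × W × _) + t • (A, w, v))
        (A, w, v) 0 := by
      simpa using ((hasDerivAt_id (0 : ℝ)).smul_const
        ((A, w, v) : _ × W × _)).const_add (one, 0, c)
    have h1 := HasFDerivAt.comp_hasDerivAt_of_eq (0 : ℝ) hstrict.hasFDerivAt hline (by simp)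
    have h2 : HasDerivAt (fun t : ℝ => (transformDefect (one + t • A) (c + t • (w : _ → _ → _ → ℝ))
        (c + t • v), c + t • v)) (coboundaryCoord c A + w - v, v) 0 := by
      refine (hasDerivAt_transformDefect c A w v).prodMk ?_
      simpa using ((hasDerivAt_id (0 : ℝ)).smul_const v).const_add c
    refine h1.unique (h2.congr_of_eventuallyEq (Eventually.of_forall fun t => ?_))
    simp [F]
  have hsurj : (fderiv ℝ F (one, 0, c)).range = ⊤ := by
    refine LinearMap.range_eq_top.2 fun ⟨u, v⟩ => ?_
    have hmem : u + v ∈ LinearMap.range (coboundaryCoord c) ⊔ W := by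
      rw [hW.sup_eq_top]; trivial
    obtain ⟨_, ⟨A, rfl⟩, w, hw, hsum⟩ := Submodule.mem_sup.1 hmem
    refine ⟨(A, ⟨w, hw⟩, v), ?_⟩
    refine (hderiv A ⟨w, hw⟩ v).trans ?_
    simp only [hsum, add_sub_cancel_right]
  have hone : ∀ d : Fin n → Fin n → Fin n → ℝ, transformDefect one d d = 0 := by
    intro d
    funext i j k
    simp [transformDefect, one, Pi.single_apply]
  have hmap : map F (𝓝 (one, 0, c)) = 𝓝 (0, c) := by
    rw [hstrict.map_nhds_eq_of_surj hsurj]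
    simp [F, hone]
  have hdet : ∀ᶠ p : (Fin n → Fin n → ℝ) × W × (Fin n → Fin n → Fin n → ℝ) in 𝓝 (one, 0, c),
      (Matrix.of p.1).det ≠ 0 ∧ ‖p.2.1‖ < ε := by
    refine Eventually.and ?_ ?_
    · have hcont : Continuous fun p : (Fin n → Fin n → ℝ) × W × (Fin n → Fin n → Fin n → ℝ) =>
          (Matrix.of p.1).det :=
        Continuous.matrix_det (A := fun p : (Fin n → Fin n → ℝ) × W ×
          (Fin n → Fin n → Fin n → ℝ) => Matrix.of p.1) continuous_fst
      refine hcont.continuousAt.eventually_ne ?_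
      have : Matrix.of one = (1 : Matrix (Fin n) (Fin n) ℝ) := by
        ext i j
        simp [one, Matrix.one_apply, Pi.single_apply, eq_comm]
      simp [this]
    · have hcont : Continuous fun p : (Fin n → Fin n → ℝ) × W × (Fin n → Fin n → Fin n → ℝ) =>
          ‖p.2.1‖ := by fun_prop
      exact hcont.continuousAt.eventually_lt_const (by simpa using hε)
  have himage := image_mem_map (m := F) hdet
  rw [hmap] at himage
  have hpair : Tendsto (fun d : Fin n → Fin n → Fin n → ℝ =>
      ((0 : Fin n → Fin n → Fin n → ℝ), d)) (𝓝 c) (𝓝 (0, c)) :=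
    Continuous.tendsto (by fun_prop) c
  filter_upwards [hpair himage] with d hd hlaw
  obtain ⟨⟨g, ⟨w, hwW⟩, d'⟩, ⟨hg, hwε⟩, hgd⟩ := hd
  obtain ⟨hdefect, rfl⟩ := Prod.mk.inj hgd
  have hrel : ∀ i j k, ∑ a, ∑ b, Matrix.of g i a * Matrix.of g j b * (c + w) a b k =
      ∑ l, d' i j l * Matrix.of g l k := fun i j k =>
    sub_eq_zero.1 (congrFun (congrFun (congrFun hdefect i) j) k)
  have hgu : IsUnit (Matrix.of g).det := isUnit_iff_ne_zero.2 hg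
  have hcw := mem_lieLaws_of_transform (Matrix.of g) hgu hrel hlaw
  have hw0 : w = 0 := by
    refine hsmall w ⟨hwW, fun i j k => ?_⟩ hwε ?_
    · have h1 := hcw.1 i j k
      have h2 := hc.1 i j k
      simp only [Pi.add_apply] at h1
      linarith
    · have h1 : jacobiCoord (c + w) (c + w) = 0 := by
        funext i j k m
        exact hcw.2 i j k m
      have h2 : jacobiCoord c c = 0 := by
        funext i j k m
        exact hc.2 i j k m
      rwa [jacobiCoord_add_self, h2, zero_add] at h1
  refine horb d' (Matrix.of g) hgu ?_
  simpa only [hw0, add_zero] using hrel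

/-- Nijenhuis and Richardson: a Lie algebra with vanishing second adjoint cohomology is rigid. -/
theorem isRigidLie_of_subsingleton_adjointH2 [FiniteDimensional ℝ L]
    [Subsingleton (adjointH2 L)] : IsRigidLie L := by
  have hZB : adjointZ2 L ≤ adjointB2 L := by
    rw [← Submodule.comap_subtype_eq_top]
    exact Submodule.Quotient.subsingleton_iff.1 ‹_›
  refine isOpen_iff_mem_nhds.2 ?_
  rintro ⟨_, hc⟩ ⟨X, rfl⟩
  have h := eventually_mem_lieOrbit X ?_
  · exact (continuous_subtype_val.continuousAt.eventually h).mono fun d hd => hd d.2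
  intro w hw hD
  have hcoc : productOf X w ∈ adjointZ2 L := by
    obtain ⟨φ, hφ⟩ : ∃ φ : LieModule.Cohomology.twoCochain ℝ L L, φ.1 = productOf X w :=
      ⟨⟨productOf X w, (productOf_self_iff X w).2 hw⟩, rfl⟩
    refine ⟨φ, (LieModule.Cohomology.mem_twoCocycle_iff ℝ L L _).2 ?_, hφ⟩
    have hJ : jacobiMap (productOf X (structureConstants X)) (productOf X w) +
        jacobiMap (productOf X w) (productOf X (structureConstants X)) = 0 := by
      refine X.ext fun i => X.ext fun j => X.ext fun k => ?_
      simp only [LinearMap.add_apply, jacobiMap_productOf_basis, ← Finset.sum_add_distrib,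
        ← add_smul]
      refine Finset.sum_eq_zero fun m _ => ?_
      have := congrFun (congrFun (congrFun (congrFun hD i) j) k) m
      rw [cocycleCoord_apply] at this
      simp only [Pi.add_apply, Pi.zero_apply] at this
      rw [this, zero_smul]
    ext x y z
    have h1 := LinearMap.congr_fun (LinearMap.congr_fun₂ hJ x y) z
    simp only [LinearMap.add_apply, jacobiMap_apply, productOf_structureConstants,
      LinearMap.zero_apply, ← hφ, LieModule.Cohomology.twoCochain_val_apply] at h1
    rw [← lie_skew (φ x y) z, ← lie_skew (φ y z) x, ← lie_skew (φ z x) y, ← lie_skew z x,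
      ← LieModule.Cohomology.twoCochain_skew φ x z, map_neg, LinearMap.neg_apply, lie_neg] at h1
    rw [LieModule.Cohomology.d₂₃_apply, LinearMap.zero_apply, LinearMap.zero_apply,
      LinearMap.zero_apply, ← neg_eq_zero, ← h1]
    abel
  obtain ⟨f, hf⟩ := hZB hcoc
  refine ⟨fun i a => X.repr (f (X i)) a, ?_⟩
  funext i j k
  have hB : ∀ x y, productOf X w x y = ⁅x, f y⁆ - ⁅y, f x⁆ - f ⁅x, y⁆ := fun x y =>
    (LinearMap.congr_fun₂ hf x y).symm
  have h1 : X.repr (productOf X w (X i) (X j)) k = w i j k := by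
    rw [productOf_basis, repr_sum_smul_basis]
  have h2 : ∀ i j, ⁅X i, f (X j)⁆ =
      ∑ k, (∑ b, X.repr (f (X j)) b * structureConstants X i b k) • X k := by
    intro i j
    rw [← productOf_structureConstants X]
    conv_lhs => rw [← X.sum_repr (f (X j))]
    simp only [map_sum, map_smul, productOf_basis, Finset.smul_sum, smul_smul, Finset.sum_smul]
    exact Finset.sum_comm
  have h3 : f ⁅X i, X j⁆ = ∑ k, (∑ l, structureConstants X i j l * X.repr (f (X l)) k) • X k := by
    rw [← productOf_structureConstants X, productOf_basis]
    simp only [map_sum, map_smul, Finset.sum_smul]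
    rw [Finset.sum_comm]
    refine Finset.sum_congr rfl fun l _ => ?_
    simp only [mul_smul, ← Finset.smul_sum, X.sum_repr]
  rw [coboundaryCoord_apply, ← h1, hB, h2, h2, h3]
  simp only [map_sub, Finsupp.sub_apply, repr_sum_smul_basis]
  have h4 : ∀ a, structureConstants X a j k = - structureConstants X j a k := fun a =>
    (structureConstants_mem_lieLaws X).1 a j k
  simp only [h4, mul_neg, Finset.sum_neg_distrib]
  ring

/-- A rigid Lie algebra is not a proper contraction: the structure constants of `H` in the bases
`Φ t (b i)` are laws that converge to those of `L`, so they end up in the orbit of `L`. -/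
theorem ContractsOnto.nonempty_lieEquiv {H : Type*} [LieRing H] [LieAlgebra ℝ H]
    [FiniteDimensional ℝ H] [TopologicalSpace H] [IsTopologicalAddGroup H] [ContinuousSMul ℝ H]
    [T2Space H] [FiniteDimensional ℝ L] (hL : IsRigidLie L) (h : ContractsOnto H L) :
    Nonempty (H ≃ₗ⁅ℝ⁆ L) := by
  obtain ⟨Φ, e, hlim⟩ := h
  let X := Module.finBasis ℝ L
  let b := X.map e.symm
  let c : ℝ → lieLaws (Module.finrank ℝ L) := fun t =>
    ⟨structureConstants (b.map (Φ t)), structureConstants_mem_lieLaws _⟩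
  have hc : Tendsto c atTop (𝓝 ⟨structureConstants X, structureConstants_mem_lieLaws X⟩) := by
    refine tendsto_subtype_rng.2 (tendsto_pi_nhds.2 fun i => tendsto_pi_nhds.2 fun j =>
      tendsto_pi_nhds.2 fun k => ?_)
    have h1 := ((b.coord k).continuous_of_finiteDimensional.tendsto _).comp (hlim (b i) (b j))
    have h2 : b.coord k (e.symm ⁅e (b i), e (b j)⁆) = structureConstants X i j k := by
      simp [b, structureConstants]
    rw [h2] at h1
    refine h1.congr fun t => ?_
    simp [c, structureConstants]
  obtain ⟨t, Y, hY⟩ := (hc.eventually (hL.mem_nhds ⟨X, rfl⟩)).exists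
  have hst : structureConstants Y = structureConstants (b.map (Φ t)) := hY
  let E : H ≃ₗ[ℝ] L := (b.map (Φ t)).equiv Y (Equiv.refl _)
  refine ⟨{ E with map_lie' := fun {x y} => ?_ }⟩
  have h1 : ((productOf Y (structureConstants Y)).compl₁₂ (E : H →ₗ[ℝ] L) (E : H →ₗ[ℝ] L)) =
      (productOf (b.map (Φ t)) (structureConstants (b.map (Φ t)))).compr₂ (E : H →ₗ[ℝ] L) := by
    refine (b.map (Φ t)).ext fun i => (b.map (Φ t)).ext fun j => ?_
    simp only [LinearMap.compl₁₂_apply, LinearMap.compr₂_apply, LinearEquiv.coe_coe, E,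
      Module.Basis.equiv_apply, Equiv.refl_apply, productOf_basis, map_sum, map_smul, hst]
  have h2 := LinearMap.congr_fun₂ h1 x y
  simp only [LinearMap.compl₁₂_apply, LinearMap.compr₂_apply, LinearEquiv.coe_coe,
    productOf_structureConstants] at h2
  exact h2.symm

end Rigidity

namespace G10

/-! ### The radical and the Levi decomposition -/

/-- The ideal spanned by `X 3, …, X 9`. -/
noncomputable def nilIdeal : LieIdeal ℝ G10 where
  carrier := {x | x 0 = 0 ∧ x 1 = 0 ∧ x 2 = 0}
  add_mem' := by
    rintro x y ⟨h0, h1, h2⟩ ⟨k0, k1, k2⟩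
    simp [h0, h1, h2, k0, k1, k2]
  zero_mem' := by simp
  smul_mem' := by
    rintro t x ⟨h0, h1, h2⟩
    simp [h0, h1, h2]
  lie_mem := by
    rintro x y ⟨h0, h1, h2⟩
    simp [bracket_def, minor, h0, h1, h2]

theorem mem_nilIdeal {x : G10} : x ∈ nilIdeal ↔ x 0 = 0 ∧ x 1 = 0 ∧ x 2 = 0 := Iff.rfl

/-- The ideal spanned by `X 7, X 8, X 9`. -/
noncomputable def abelianIdeal : LieIdeal ℝ G10 where
  carrier := {x | ∀ i < 7, x i = 0}
  add_mem' := fun hx hy i hi => by simp [hx i hi, hy i hi]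
  zero_mem' := by simp
  smul_mem' := fun t x hx i hi => by simp [hx i hi]
  lie_mem := by
    intro x y hy i hi
    have h0 := hy 0 (by decide)
    have h1 := hy 1 (by decide)
    have h2 := hy 2 (by decide)
    have h3 := hy 3 (by decide)
    have h4 := hy 4 (by decide)
    have h5 := hy 5 (by decide)
    have h6 := hy 6 (by decide)
    revert hi
    fin_cases i <;> simp [bracket_def, minor, h0, h1, h2, h3, h4, h5, h6]

theorem lie_mem_abelianIdeal {x y : G10} (hx : x ∈ nilIdeal) (hy : y ∈ nilIdeal) :
    ⁅x, y⁆ ∈ abelianIdeal := by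
  obtain ⟨h0, h1, h2⟩ := hx
  obtain ⟨k0, k1, k2⟩ := hy
  intro i hi
  revert hi
  fin_cases i <;> simp [bracket_def, minor, h0, h1, h2, k0, k1, k2]

theorem lie_eq_zero_of_mem_abelianIdeal {x y : G10} (hx : x ∈ abelianIdeal)
    (hy : y ∈ abelianIdeal) : ⁅x, y⁆ = 0 := by
  have h : ∀ i j : Fin 10, i < 7 → minor x y i j = 0 := fun i j hi => by
    simp [minor, hx i hi, hy i hi]
  ext i
  rw [bracket_def]
  fin_cases i <;> simp [h]

theorem isSolvable_nilIdeal : LieAlgebra.IsSolvable nilIdeal := by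
  have h1 : LieAlgebra.derivedSeriesOfIdeal ℝ G10 1 nilIdeal ≤ abelianIdeal := by
    rw [LieAlgebra.derivedSeriesOfIdeal_succ, LieAlgebra.derivedSeriesOfIdeal_zero,
      LieSubmodule.lie_le_iff]
    exact fun x hx y hy => lie_mem_abelianIdeal hx hy
  have h2 : LieAlgebra.derivedSeriesOfIdeal ℝ G10 2 nilIdeal = ⊥ := by
    rw [LieAlgebra.derivedSeriesOfIdeal_succ, LieSubmodule.lie_eq_bot_iff]
    exact fun x hx y hy => lie_eq_zero_of_mem_abelianIdeal (h1 hx) (h1 hy)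
  exact LieAlgebra.IsSolvable.mk ((LieIdeal.derivedSeries_eq_bot_iff nilIdeal 2).2 h2)

/-- An ideal not contained in `nilIdeal` contains an element that is congruent to a non-zero
multiple of `X 1` modulo `nilIdeal`. -/
theorem exists_mem_of_not_le_nilIdeal {I : LieIdeal ℝ G10} (hI : ¬ I ≤ nilIdeal) :
    ∃ x ∈ I, x 0 = 0 ∧ x 1 ≠ 0 ∧ x 2 = 0 := by
  obtain ⟨x, hx, hxn⟩ := SetLike.not_le_iff_exists.1 hI
  have h1 : ⁅X 1, x⁆ ∈ I := I.lie_mem hx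
  have h2 : ⁅X 1, ⁅X 1, x⁆⁆ ∈ I := I.lie_mem h1
  by_cases hc : x 2 = 0
  · by_cases ha : x 0 = 0
    · refine ⟨x, hx, ha, fun hb => hxn ⟨ha, hb, hc⟩, hc⟩
    · refine ⟨_, h1, ?_, ?_, ?_⟩ <;> simp [bracket_def, minor, X_apply, hc, ha]
  · refine ⟨_, h2, ?_, ?_, ?_⟩ <;> simp [bracket_def, minor, X_apply, hc]

theorem derivedSeriesOfIdeal_not_le_nilIdeal {I : LieIdeal ℝ G10} (hI : ¬ I ≤ nilIdeal) (k : ℕ) :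
    ¬ LieAlgebra.derivedSeriesOfIdeal ℝ G10 k I ≤ nilIdeal := by
  induction k with
  | zero => exact hI
  | succ k ih =>
    obtain ⟨x, hx, h0, h1, h2⟩ := exists_mem_of_not_le_nilIdeal ih
    intro hle
    rw [LieAlgebra.derivedSeriesOfIdeal_succ] at hle
    have h := hle (LieSubmodule.lie_mem_lie hx (LieSubmodule.lie_mem _ (x := X 2) hx))
    have h' := h.2.1
    simp [bracket_def, minor, X_apply, h0, h1, h2] at h'

theorem radical_eq_nilIdeal : LieAlgebra.radical ℝ G10 = nilIdeal := by
  refine le_antisymm (sSup_le fun I hI => ?_) (le_sSup isSolvable_nilIdeal)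
  by_contra hle
  obtain ⟨k, hk⟩ := (LieAlgebra.isSolvable_iff (R := ℝ) (L := I)).1 hI
  rw [LieIdeal.derivedSeries_eq_bot_iff] at hk
  exact derivedSeriesOfIdeal_not_le_nilIdeal hle k (hk ▸ bot_le)

theorem nilIdeal_toSubmodule :
    nilIdeal.toSubmodule = Submodule.span ℝ (X '' {i : Fin 10 | 3 ≤ i}) := by
  ext x
  rw [Module.Basis.mem_span_image]
  change (x 0 = 0 ∧ x 1 = 0 ∧ x 2 = 0) ↔ _
  have hr : ∀ i, X.repr x i = x i := fun i => rfl
  have h : (↑(X.repr x).support ⊆ {i : Fin 10 | 3 ≤ i}) ↔ ∀ i, x i ≠ 0 → 3 ≤ i := by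
    simp only [Set.subset_def, Finset.mem_coe, Finsupp.mem_support_iff, hr, Set.mem_ofPred_eq]
  rw [h]
  constructor
  · rintro ⟨h0, h1, h2⟩ i hi
    fin_cases i <;> first | contradiction | decide
  · intro h
    refine ⟨?_, ?_, ?_⟩ <;> by_contra hne <;> exact absurd (h _ hne) (by decide)

theorem sl_apply_one_one (A : LieAlgebra.SpecialLinear.sl (Fin 2) ℝ) :
    A.val 1 1 = -A.val 0 0 := by
  have h : A.val.trace = 0 := A.2
  rw [Matrix.trace_fin_two] at h
  linarith

/-- Elements of `sl(2, ℝ)` are determined by three of their entries. -/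
theorem sl_ext {A B : LieAlgebra.SpecialLinear.sl (Fin 2) ℝ} (h₀ : A.val 0 0 = B.val 0 0)
    (h₁ : A.val 0 1 = B.val 0 1) (h₂ : A.val 1 0 = B.val 1 0) : A = B := by
  apply Subtype.ext
  ext i j
  fin_cases i <;> fin_cases j
  · exact h₀
  · exact h₁
  · exact h₂
  · change A.val 1 1 = B.val 1 1
    rw [sl_apply_one_one, sl_apply_one_one, h₀]

/-- The element of `sl(2, ℝ)` with the given entries. -/
def slOf (a b c : ℝ) : LieAlgebra.SpecialLinear.sl (Fin 2) ℝ :=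
  ⟨!![a, b; c, -a], show Matrix.trace !![a, b; c, -a] = 0 by simp [Matrix.trace_fin_two]⟩

@[simp] theorem slOf_apply_zero_zero (a b c : ℝ) : (slOf a b c).val 0 0 = a := rfl

@[simp] theorem slOf_apply_zero_one (a b c : ℝ) : (slOf a b c).val 0 1 = b := rfl

@[simp] theorem slOf_apply_one_zero (a b c : ℝ) : (slOf a b c).val 1 0 = c := rfl

theorem sl_lie_apply (A B : LieAlgebra.SpecialLinear.sl (Fin 2) ℝ) (i j : Fin 2) :
    ⁅A, B⁆.val i j =
      A.val i 0 * B.val 0 j + A.val i 1 * B.val 1 j -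
        (B.val i 0 * A.val 0 j + B.val i 1 * A.val 1 j) := by
  rw [LieAlgebra.SpecialLinear.sl_bracket]
  simp [Matrix.mul_apply, Fin.sum_univ_two]

/-- The embedding of `sl(2, ℝ)` with image spanned by `X 0, X 1, X 2`. -/
noncomputable def leviHom : LieAlgebra.SpecialLinear.sl (Fin 2) ℝ →ₗ⁅ℝ⁆ G10 where
  toFun A := mk ![A.val 0 0, A.val 0 1, A.val 1 0, 0, 0, 0, 0, 0, 0, 0]
  map_add' A B := by ext i; fin_cases i <;> simp
  map_smul' t A := by ext i; fin_cases i <;> simp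
  map_lie' {A B} := by
    simp only [sl_lie_apply, sl_apply_one_one]
    ext i
    fin_cases i <;> simp [bracket_def, minor] <;> ring

theorem leviHom_apply (A : LieAlgebra.SpecialLinear.sl (Fin 2) ℝ) :
    leviHom A = mk ![A.val 0 0, A.val 0 1, A.val 1 0, 0, 0, 0, 0, 0, 0, 0] := rfl

/-- The action of `sl(2, ℝ)` on the radical by derivations. -/
noncomputable def leviAction : LieAlgebra.SpecialLinear.sl (Fin 2) ℝ →ₗ⁅ℝ⁆
    LieDerivation ℝ (LieAlgebra.radical ℝ G10) (LieAlgebra.radical ℝ G10) where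
  toFun A :=
    { toFun := fun r => ⁅leviHom A, r⁆
      map_add' := fun r s => lie_add _ _ _
      map_smul' := fun t r => lie_smul _ _ _
      leibniz' := fun r s => by
        apply Subtype.ext
        simp only [LinearMap.coe_mk, AddHom.coe_mk, LieSubmodule.coe_sub, LieSubmodule.coe_bracket,
          LieIdeal.coe_bracket_of_module]
        rw [leibniz_lie, ← lie_skew _ (s : G10)]
        abel }
  map_add' A B := by
    ext r
    simp
  map_smul' t A := by
    ext r
    simp
  map_lie' {A B} := by
    ext r
    simp

theorem coe_leviAction_apply (A : LieAlgebra.SpecialLinear.sl (Fin 2) ℝ)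
    (r : LieAlgebra.radical ℝ G10) : (leviAction A r : G10) = ⁅leviHom A, (r : G10)⁆ := rfl

theorem mem_radical {x : G10} : x ∈ LieAlgebra.radical ℝ G10 ↔ x 0 = 0 ∧ x 1 = 0 ∧ x 2 = 0 := by
  rw [radical_eq_nilIdeal, mem_nilIdeal]

/-- The map `(r, A) ↦ r + leviHom A` from the semidirect sum. -/
noncomputable def ofSemiDirectSum :
    LieAlgebra.SemiDirectSum (LieAlgebra.radical ℝ G10)
      (LieAlgebra.SpecialLinear.sl (Fin 2) ℝ) leviAction →ₗ⁅ℝ⁆ G10 where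
  toFun s := s.left + leviHom s.right
  map_add' s t := by
    simp only [LieAlgebra.SemiDirectSum.add_eq_mk, map_add, LieSubmodule.coe_add]
    abel
  map_smul' c s := by
    simp [LieAlgebra.SemiDirectSum.smul_eq_mk]
  map_lie' {s t} := by
    simp only [LieAlgebra.SemiDirectSum.lie_eq_mk, LieSubmodule.coe_add, LieSubmodule.coe_sub,
      coe_leviAction_apply, lie_add, add_lie, LieHom.map_lie]
    rw [← lie_skew (s.left : G10) (leviHom t.right)]
    change ⁅(s.left : G10), (t.left : G10)⁆ + _ - _ + _ = _
    abel

theorem ofSemiDirectSum_apply (s : LieAlgebra.SemiDirectSum (LieAlgebra.radical ℝ G10)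
      (LieAlgebra.SpecialLinear.sl (Fin 2) ℝ) leviAction) :
    ofSemiDirectSum s = s.left + leviHom s.right := rfl

theorem bijective_ofSemiDirectSum : Function.Bijective ofSemiDirectSum := by
  constructor
  · rw [← LieHom.coe_toLinearMap, ← LinearMap.ker_eq_bot, LinearMap.ker_eq_bot']
    rintro ⟨r, A⟩ h
    have h' : (r : G10) + leviHom A = 0 := h
    obtain ⟨k0, k1, k2⟩ := mem_radical.1 r.2
    have c : ∀ i, (r : G10) i + leviHom A i = 0 := fun i => by
      rw [← add_apply, h', zero_apply]
    have c0 := c 0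
    have c1 := c 1
    have c2 := c 2
    simp [leviHom_apply, k0, k1, k2] at c0 c1 c2
    have hA : A = 0 := sl_ext c0 c1 c2
    subst hA
    have hr : r = 0 := by
      apply Subtype.ext
      simpa using h'
    subst hr
    rfl
  · intro x
    let A := slOf (x 0) (x 1) (x 2)
    have hr : x - leviHom A ∈ LieAlgebra.radical ℝ G10 := by
      rw [mem_radical]
      simp [sub_eq_add_neg, leviHom_apply, A]
    exact ⟨⟨⟨_, hr⟩, A⟩, by simp [ofSemiDirectSum_apply]⟩

/-- The radical as a representation space of `sl(2, ℝ)`: the subspaces spanned by `X 7, X 8, X 9`,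
by `X 3, X 4` and by `X 5, X 6` carry the adjoint and two standard representations. -/
noncomputable def radicalEquiv : LieAlgebra.radical ℝ G10 ≃ₗ[ℝ]
    LieAlgebra.SpecialLinear.sl (Fin 2) ℝ × (Fin 2 → ℝ) × (Fin 2 → ℝ) where
  toFun r := (slOf (-(r : G10) 8) ((r : G10) 7) (-(r : G10) 9), ![(r : G10) 3, (r : G10) 4],
    ![(r : G10) 5, (r : G10) 6])
  map_add' r s := by
    refine Prod.ext (sl_ext ?_ ?_ ?_) (Prod.ext ?_ ?_)
    · exact neg_add _ _
    · rfl
    · exact neg_add _ _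
    · exact List.ofFn_inj.1 rfl
    · exact List.ofFn_inj.1 rfl
  map_smul' t r := by
    refine Prod.ext (sl_ext ?_ ?_ ?_) (Prod.ext ?_ ?_)
    · exact (mul_neg _ _).symm
    · rfl
    · exact (mul_neg _ _).symm
    · exact List.ofFn_inj.1 rfl
    · exact List.ofFn_inj.1 rfl
  invFun p := ⟨mk ![0, 0, 0, p.2.1 0, p.2.1 1, p.2.2 0, p.2.2 1, p.1.val 0 1, -p.1.val 0 0,
    -p.1.val 1 0], mem_radical.2 ⟨rfl, rfl, rfl⟩⟩
  left_inv r := by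
    obtain ⟨k0, k1, k2⟩ := mem_radical.1 r.2
    apply Subtype.ext
    ext i
    fin_cases i <;> simp [k0, k1, k2]
  right_inv p := by
    refine Prod.ext (sl_ext ?_ ?_ ?_) (Prod.ext ?_ ?_)
    · exact neg_neg _
    · rfl
    · exact neg_neg _
    · exact List.ofFn_inj.1 rfl
    · exact List.ofFn_inj.1 rfl

theorem radicalEquiv_apply (r : LieAlgebra.radical ℝ G10) : radicalEquiv r =
    (slOf (-(r : G10) 8) ((r : G10) 7) (-(r : G10) 9), ![(r : G10) 3, (r : G10) 4],
      ![(r : G10) 5, (r : G10) 6]) := rfl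

theorem radicalEquiv_leviAction (A : LieAlgebra.SpecialLinear.sl (Fin 2) ℝ)
    (r : LieAlgebra.radical ℝ G10) : radicalEquiv (leviAction A r) =
      (⁅A, (radicalEquiv r).1⁆, A.val.mulVec (radicalEquiv r).2.1,
        A.val.mulVec (radicalEquiv r).2.2) := by
  obtain ⟨k0, k1, k2⟩ := mem_radical.1 r.2
  simp only [radicalEquiv_apply, coe_leviAction_apply]
  refine Prod.ext (sl_ext ?_ ?_ ?_) (Prod.ext ?_ ?_)
  · rw [sl_lie_apply]
    simp [leviHom_apply, bracket_def, minor, k0, k1, k2]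
    ring
  · rw [sl_lie_apply]
    simp [leviHom_apply, bracket_def, minor, k0, k1, k2, sl_apply_one_one]
    ring
  · rw [sl_lie_apply]
    simp [leviHom_apply, bracket_def, minor, k0, k1, k2, sl_apply_one_one]
    ring
  · ext i
    fin_cases i <;>
      simp [leviHom_apply, bracket_def, minor, k0, k1, k2, sl_apply_one_one, Matrix.mulVec,
        dotProduct, Fin.sum_univ_two, add_comm]
  · ext i
    fin_cases i <;>
      simp [leviHom_apply, bracket_def, minor, k0, k1, k2, sl_apply_one_one, Matrix.mulVec,
        dotProduct, Fin.sum_univ_two, add_comm]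

/-! ### The invariant form and the Casimir operator -/

/-- The non-degenerate invariant form of `G10`. -/
noncomputable def form : LinearMap.BilinForm ℝ G10 :=
  LinearMap.mk₂ ℝ (fun x y => 2 * (x 0 * y 8 + x 8 * y 0) + (x 1 * y 9 + x 9 * y 1) -
      (x 2 * y 7 + x 7 * y 2) + 2 * (x 3 * y 6 + x 6 * y 3) - 2 * (x 4 * y 5 + x 5 * y 4))
    (fun _ _ _ => by simp only [add_apply]; ring)
    (fun _ _ _ => by simp only [smul_apply, smul_eq_mul]; ring)
    (fun _ _ _ => by simp only [add_apply]; ring)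
    (fun _ _ _ => by simp only [smul_apply, smul_eq_mul]; ring)

theorem form_apply (x y : G10) : form x y =
    2 * (x 0 * y 8 + x 8 * y 0) + (x 1 * y 9 + x 9 * y 1) - (x 2 * y 7 + x 7 * y 2) +
      2 * (x 3 * y 6 + x 6 * y 3) - 2 * (x 4 * y 5 + x 5 * y 4) := rfl

theorem form_comm (x y : G10) : form x y = form y x := by
  simp only [form_apply]
  ring

theorem form_lie (x y z : G10) : form x ⁅y, z⁆ = form ⁅x, y⁆ z := by
  simp [form_apply, bracket_def, minor]
  ring

theorem form_lie_skew (x y z : G10) : form ⁅x, y⁆ z = -form ⁅x, z⁆ y := by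
  rw [← lie_skew, map_neg, LinearMap.neg_apply, ← form_lie, form_comm]

/-- The involution of the indices for which `X i` and `X (dual i)` are paired by `form`. -/
def dual : Fin 10 → Fin 10 := ![8, 9, 7, 6, 5, 4, 3, 2, 0, 1]

/-- The inverse of the value of `form` on the pair `X i`, `X (dual i)`. -/
noncomputable def casimirCoeff : Fin 10 → ℝ :=
  ![1 / 2, 1, -1, 1 / 2, -1 / 2, -1 / 2, 1 / 2, -1, 1 / 2, 1]

theorem dual_dual : Function.Involutive dual := by
  unfold Function.Involutive
  decide

theorem casimirCoeff_dual (i : Fin 10) : casimirCoeff (dual i) = casimirCoeff i := by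
  fin_cases i <;> rfl

theorem casimirCoeff_ne_zero (i : Fin 10) : casimirCoeff i ≠ 0 := by
  fin_cases i <;> norm_num [casimirCoeff]

theorem apply_eq_form (x : G10) (i : Fin 10) :
    x i = casimirCoeff i * form x (X (dual i)) := by
  fin_cases i <;> simp [form_apply, X_apply, dual, casimirCoeff] <;> ring

theorem isQuasiClassical : IsQuasiClassical G10 :=
  ⟨form, form_comm, form_lie, fun x hx => ext fun i => by
    rw [apply_eq_form x, hx, mul_zero, zero_apply]⟩

/-- The symmetric matrix of `casimirPolynomial`: the inverse of the Gram matrix of `form`. -/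
noncomputable def casimirMatrix : Matrix (Fin 10) (Fin 10) ℝ :=
  Matrix.of fun a b => if b = dual a then casimirCoeff a else 0

theorem casimirMatrix_apply (a b : Fin 10) :
    casimirMatrix a b = if b = dual a then casimirCoeff a else 0 := rfl

theorem isSymm_casimirMatrix : casimirMatrix.IsSymm := by
  ext a b
  rw [Matrix.transpose_apply, casimirMatrix_apply, casimirMatrix_apply]
  by_cases h : a = dual b
  · rw [if_pos h, if_pos (by rw [h, dual_dual]), h, casimirCoeff_dual]
  · rw [if_neg h, if_neg fun h' => h (by rw [h', dual_dual])]

theorem isUnit_det_casimirMatrix : IsUnit casimirMatrix.det := by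
  rw [← Matrix.isUnit_iff_isUnit_det]
  have h : casimirMatrix *
      (Matrix.of fun a b => if b = dual a then (casimirCoeff a)⁻¹ else 0) = 1 := by
    ext a b
    simp only [Matrix.mul_apply, casimirMatrix_apply, Matrix.of_apply, ite_mul, zero_mul,
      Finset.sum_ite_eq', Finset.mem_univ, if_true, dual_dual a,
      casimirCoeff_dual, Matrix.one_apply]
    by_cases hab : b = a
    · rw [if_pos hab, if_pos hab.symm, mul_inv_cancel₀ (casimirCoeff_ne_zero a)]
    · rw [if_neg hab, if_neg (Ne.symm hab), mul_zero]
  exact IsUnit.of_mul_eq_one _ h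

theorem sum_casimirMatrix : ∑ a, ∑ b, MvPolynomial.C (casimirMatrix a b) * MvPolynomial.X a *
    MvPolynomial.X b = casimirPolynomial := by
  have h : ∀ a, ∑ b, MvPolynomial.C (casimirMatrix a b) * MvPolynomial.X a * MvPolynomial.X b =
      MvPolynomial.C (casimirCoeff a) * MvPolynomial.X a *
        (MvPolynomial.X (dual a) : MvPolynomial (Fin 10) ℝ) := by
    intro a
    rw [Finset.sum_eq_single (dual a)]
    · rw [casimirMatrix_apply, if_pos rfl]
    · intro b _ hb
      rw [casimirMatrix_apply, if_neg hb, map_zero, zero_mul, zero_mul]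
    · exact fun h => absurd (Finset.mem_univ _) h
  have h2 : (MvPolynomial.C (1 / 2 : ℝ) : MvPolynomial (Fin 10) ℝ) * 2 = 1 := by
    rw [← map_ofNat MvPolynomial.C 2, ← map_mul]
    norm_num
  have h3 : (MvPolynomial.C (-1 / 2 : ℝ) : MvPolynomial (Fin 10) ℝ) =
      -MvPolynomial.C (1 / 2 : ℝ) := by
    rw [← map_neg]
    norm_num
  simp only [h, Fin.sum_univ_succ, Fin.sum_univ_zero]
  simp [casimirPolynomial, dual, casimirCoeff, -one_div, h3]
  linear_combination (MvPolynomial.X 0 * MvPolynomial.X 8 + MvPolynomial.X 3 * MvPolynomial.X 6 -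
    MvPolynomial.X 4 * MvPolynomial.X 5) * h2

section EnvelopingAlgebra

open UniversalEnvelopingAlgebra

attribute [local instance] LieRing.ofAssociativeRing

theorem quadraticOperator_casimirMatrix : quadraticOperator X casimirMatrix =
    ∑ a, casimirCoeff a • (ι ℝ (X a) * ι ℝ (X (dual a))) := by
  refine Finset.sum_congr rfl fun a _ => ?_
  rw [Finset.sum_eq_single (dual a)]
  · rw [casimirMatrix_apply, if_pos rfl]
  · intro b _ hb
    rw [casimirMatrix_apply, if_neg hb, zero_smul]
  · exact fun h => absurd (Finset.mem_univ _) h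

/-- The quadratic operator commutes with `G10`: by invariance of `form`, the coordinates of
`⁅x, X (dual b)⁆` and `⁅x, X (dual d)⁆` that enter the commutator cancel in pairs. -/
theorem commute_quadraticOperator (x : G10) :
    ι ℝ x * quadraticOperator X casimirMatrix = quadraticOperator X casimirMatrix * ι ℝ x := by
  have hι : ∀ y : G10, ι ℝ y = ∑ d, y d • ι ℝ (X d) := by
    intro y
    conv_lhs => rw [← X.sum_repr y]
    rw [map_sum]
    exact Finset.sum_congr rfl fun d _ => by rw [map_smul]; rfl
  have hlie : ∀ y : G10, ι ℝ x * ι ℝ y = ι ℝ y * ι ℝ x + ι ℝ ⁅x, y⁆ := by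
    intro y
    rw [LieHom.map_lie, Ring.lie_def]
    abel
  have hterm : ∀ a, ι ℝ x * (ι ℝ (X a) * ι ℝ (X (dual a))) =
      ι ℝ (X a) * ι ℝ (X (dual a)) * ι ℝ x +
        (ι ℝ ⁅x, X a⁆ * ι ℝ (X (dual a)) + ι ℝ (X a) * ι ℝ ⁅x, X (dual a)⁆) := by
    intro a
    rw [← mul_assoc, hlie, add_mul, mul_assoc, hlie, mul_add, ← mul_assoc]
    abel
  have hcoef : ∀ d b, casimirCoeff b * ⁅x, X (dual b)⁆ d +
      casimirCoeff d * ⁅x, X (dual d)⁆ b = 0 := by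
    intro d b
    rw [apply_eq_form ⁅x, X (dual b)⁆ d, apply_eq_form ⁅x, X (dual d)⁆ b, form_lie_skew]
    ring
  rw [quadraticOperator_casimirMatrix, Finset.mul_sum, Finset.sum_mul]
  simp only [mul_smul_comm, smul_mul_assoc, hterm, smul_add, Finset.sum_add_distrib]
  rw [add_eq_left]
  have h1 : ∑ a, casimirCoeff a • (ι ℝ ⁅x, X a⁆ * ι ℝ (X (dual a))) =
      ∑ b, ∑ d, (casimirCoeff b * ⁅x, X (dual b)⁆ d) • (ι ℝ (X d) * ι ℝ (X b)) := by
    rw [← Equiv.sum_comp dual_dual.toPerm]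
    refine Finset.sum_congr rfl fun b _ => ?_
    simp only [Function.Involutive.coe_toPerm, dual_dual b, casimirCoeff_dual]
    rw [hι ⁅x, X (dual b)⁆, Finset.sum_mul, Finset.smul_sum]
    simp only [smul_mul_assoc, smul_smul]
  have h2 : ∑ a, casimirCoeff a • (ι ℝ (X a) * ι ℝ ⁅x, X (dual a)⁆) =
      ∑ d, ∑ b, (casimirCoeff d * ⁅x, X (dual d)⁆ b) • (ι ℝ (X d) * ι ℝ (X b)) := by
    refine Finset.sum_congr rfl fun d _ => ?_
    rw [hι ⁅x, X (dual d)⁆, Finset.mul_sum, Finset.smul_sum]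
    simp only [mul_smul_comm, smul_smul]
  rw [h1, h2, Finset.sum_comm]
  simp only [← Finset.sum_add_distrib, ← add_smul, hcoef, zero_smul, Finset.sum_const_zero]

/-- As the enveloping algebra is generated by `L`, centrality can be tested on `L`. -/
theorem mem_center_of_commute_ι {L : Type*} [LieRing L] [LieAlgebra ℝ L]
    {z : UniversalEnvelopingAlgebra ℝ L} (hz : ∀ x, ι ℝ x * z = z * ι ℝ x) :
    z ∈ Subalgebra.center ℝ (UniversalEnvelopingAlgebra ℝ L) := by
  have hmem : ∀ x, ι ℝ x ∈ Subalgebra.centralizer ℝ {z} := fun x =>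
    Subalgebra.mem_centralizer_iff ℝ |>.2 fun g hg => by
      rw [Set.mem_singleton_iff.1 hg, hz]
  let f : L →ₗ⁅ℝ⁆ Subalgebra.centralizer ℝ {z} :=
    { toFun := fun x => ⟨ι ℝ x, hmem x⟩
      map_add' := fun x y => Subtype.ext (map_add _ _ _)
      map_smul' := fun t x => Subtype.ext (map_smul _ _ _)
      map_lie' := fun {x y} => Subtype.ext (LieHom.map_lie _ _ _) }
  have hid : (Subalgebra.val _).comp (lift ℝ f) = AlgHom.id ℝ _ := by
    apply hom_ext
    ext x
    simp [f]
  refine Subalgebra.mem_center_iff.2 fun b => ?_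
  have hb : (lift ℝ f b : UniversalEnvelopingAlgebra ℝ L) = b := congrArg (fun g => g b) hid
  rw [← hb]
  exact ((Subalgebra.mem_centralizer_iff ℝ).1 (lift ℝ f b).2 z rfl).symm

end EnvelopingAlgebra

/-! ### The cocycle equations of weight zero -/

/-- The weights of the basis vectors under `ad (X 0)`. -/
def weight : Fin 10 → ℤ := ![0, 2, -2, 1, -1, 1, -1, 2, 0, -2]

theorem lie_X_zero_apply (v : G10) (k : Fin 10) : ⁅X 0, v⁆ k = weight k * v k := by
  fin_cases k <;> simp [bracket_def, minor, X_apply, weight]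

theorem lie_X_zero_X (j : Fin 10) : ⁅X 0, X j⁆ = (weight j : ℝ) • X j := by
  ext k
  rw [lie_X_zero_apply, smul_apply, X_apply]
  split_ifs with h
  · rw [h]
  · simp

/-- The array `c` consists of the coordinates of a 2-cocycle with values in `G10`. -/
structure IsCocycleCoord (c : Fin 10 → Fin 10 → Fin 10 → ℝ) : Prop where
  self : ∀ i k, c i i k = 0
  skew : ∀ i j k, j < i → c i j k = -c j i k
  cocycle : ∀ i j k m, ⁅X i, mk (c j k)⁆ m - ⁅X j, mk (c i k)⁆ m + ⁅X k, mk (c i j)⁆ m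
    - ∑ l, ⁅X i, X j⁆ l * c l k m + ∑ l, ⁅X i, X k⁆ l * c l j m - ∑ l, ⁅X j, X k⁆ l * c l i m = 0

/- The grading of `G10` in which `X 0, X 1, X 2` have degree `(0, 0)`, `X 3, X 4` degree `(1, 0)`,
`X 5, X 6` degree `(0, 1)` and `X 7, X 8, X 9` degree `(1, 1)` splits the cocycle equations: the
coordinate `c i j k` has degree `deg k - deg i - deg j`, and every equation is homogeneous. The
following lemmas list, degree by degree, the coordinates `c i j k` with `i < j` and
`weight k = weight i + weight j`; those that serve as free parameters are assumed to be zero, and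
the equations then force the others to vanish. -/

theorem IsCocycleCoord.bidegree_neg_two_neg_two {c : Fin 10 → Fin 10 → Fin 10 → ℝ}
    (h : IsCocycleCoord c) :
    c 7 8 1 = 0 ∧ c 7 9 0 = 0 ∧ c 8 9 2 = 0 := by
  have e1 := h.cocycle 3 5 8 1
  have e2 := h.cocycle 3 5 9 0
  have e3 := h.cocycle 3 6 9 2
  simp [bracket_def, minor, X_apply, Fin.sum_univ_succ, h.self, h.skew] at e1 e2 e3
  refine ⟨?_, ?_, ?_⟩ <;> linarith

theorem IsCocycleCoord.bidegree_neg_two_zero {c : Fin 10 → Fin 10 → Fin 10 → ℝ}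
    (h : IsCocycleCoord c) :
    c 3 4 0 = 0 ∧ c 3 8 5 = 0 ∧ c 3 9 6 = 0 ∧ c 4 7 5 = 0 ∧ c 4 8 6 = 0 := by
  have e1 := h.cocycle 1 3 4 1
  have e2 := h.cocycle 1 3 9 5
  have e3 := h.cocycle 1 4 9 6
  have e4 := h.cocycle 2 3 7 5
  have e5 := h.cocycle 3 4 7 7
  simp [bracket_def, minor, X_apply, Fin.sum_univ_succ, h.self, h.skew] at e1 e2 e3 e4 e5
  refine ⟨?_, ?_, ?_, ?_, ?_⟩ <;> linarith

theorem IsCocycleCoord.bidegree_neg_one_neg_one {c : Fin 10 → Fin 10 → Fin 10 → ℝ}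
    (h : IsCocycleCoord c) (h181 : c 1 8 1 = 0) (h190 : c 1 9 0 = 0) (h351 : c 3 5 1 = 0) :
    c 0 7 1 = 0 ∧ c 0 8 0 = 0 ∧ c 0 9 2 = 0 ∧ c 2 7 0 = 0 ∧ c 2 8 2 = 0 ∧ c 3 6 0 = 0 ∧
      c 3 8 3 = 0 ∧ c 3 9 4 = 0 ∧ c 4 5 0 = 0 ∧ c 4 6 2 = 0 ∧ c 4 7 3 = 0 ∧ c 4 8 4 = 0 ∧
      c 5 8 5 = 0 ∧ c 5 9 6 = 0 ∧ c 6 7 5 = 0 ∧ c 6 8 6 = 0 ∧ c 7 8 7 = 0 ∧ c 7 9 8 = 0 ∧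
      c 8 9 9 = 0 := by
  have e1 := h.cocycle 0 3 5 1
  have e2 := h.cocycle 0 3 6 0
  have e3 := h.cocycle 0 3 9 4
  have e4 := h.cocycle 1 3 6 1
  have e5 := h.cocycle 1 4 5 1
  have e6 := h.cocycle 1 2 7 1
  have e7 := h.cocycle 1 2 9 2
  have e8 := h.cocycle 1 3 9 3
  have e9 := h.cocycle 1 4 9 4
  have e10 := h.cocycle 1 5 9 5
  have e11 := h.cocycle 1 6 9 6
  have e12 := h.cocycle 1 7 9 7
  have e13 := h.cocycle 1 8 9 8
  have e14 := h.cocycle 3 6 8 8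
  have e15 := h.cocycle 1 4 6 0
  have e16 := h.cocycle 1 4 8 3
  have e17 := h.cocycle 1 6 8 5
  have e18 := h.cocycle 3 4 5 3
  have e19 := h.cocycle 3 5 8 7
  simp [bracket_def, minor, X_apply, Fin.sum_univ_succ, h.self, h.skew] at e1 e2 e3 e4 e5 e6 e7 e8
  simp [bracket_def, minor, X_apply, Fin.sum_univ_succ, h.self, h.skew]
    at e9 e10 e11 e12 e13 e14 e15 e16
  simp [bracket_def, minor, X_apply, Fin.sum_univ_succ, h.self, h.skew] at e17 e18 e19
  refine ⟨?_, ?_, ?_, ?_, ?_, ?_, ?_, ?_, ?_, ?_, ?_, ?_, ?_, ?_, ?_, ?_, ?_, ?_, ?_⟩ <;> linarith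

theorem IsCocycleCoord.bidegree_neg_one_one {c : Fin 10 → Fin 10 → Fin 10 → ℝ}
    (h : IsCocycleCoord c) (h145 : c 1 4 5 = 0) :
    c 0 3 5 = 0 ∧ c 0 4 6 = 0 ∧ c 2 3 6 = 0 ∧ c 3 4 8 = 0 := by
  have e1 := h.cocycle 1 3 4 7
  have e2 := h.cocycle 0 1 4 5
  have e3 := h.cocycle 1 2 3 5
  have e4 := h.cocycle 1 2 4 6
  simp [bracket_def, minor, X_apply, Fin.sum_univ_succ, h.self, h.skew] at e1 e2 e3 e4
  refine ⟨?_, ?_, ?_, ?_⟩ <;> linarith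

theorem IsCocycleCoord.bidegree_zero_neg_two {c : Fin 10 → Fin 10 → Fin 10 → ℝ}
    (h : IsCocycleCoord c) :
    c 5 6 0 = 0 ∧ c 5 8 3 = 0 ∧ c 5 9 4 = 0 ∧ c 6 7 3 = 0 ∧ c 6 8 4 = 0 := by
  have e1 := h.cocycle 1 5 6 1
  have e2 := h.cocycle 1 5 9 3
  have e3 := h.cocycle 1 6 9 4
  have e4 := h.cocycle 2 5 7 3
  have e5 := h.cocycle 5 6 7 7
  simp [bracket_def, minor, X_apply, Fin.sum_univ_succ, h.self, h.skew] at e1 e2 e3 e4 e5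
  refine ⟨?_, ?_, ?_, ?_, ?_⟩ <;> linarith

theorem IsCocycleCoord.bidegree_zero_zero {c : Fin 10 → Fin 10 → Fin 10 → ℝ}
    (h : IsCocycleCoord c) (h011 : c 0 1 1 = 0)
    (h120 : c 1 2 0 = 0) (h143 : c 1 4 3 = 0) (h165 : c 1 6 5 = 0)
    (h187 : c 1 8 7 = 0) (h198 : c 1 9 8 = 0) (h357 : c 3 5 7 = 0) :
    c 0 2 2 = 0 ∧ c 0 3 3 = 0 ∧ c 0 4 4 = 0 ∧ c 0 5 5 = 0 ∧ c 0 6 6 = 0 ∧ c 0 7 7 = 0 ∧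
      c 0 8 8 = 0 ∧ c 0 9 9 = 0 ∧ c 2 3 4 = 0 ∧ c 2 5 6 = 0 ∧ c 2 7 8 = 0 ∧ c 2 8 9 = 0 ∧
      c 3 6 8 = 0 ∧ c 4 5 8 = 0 ∧ c 4 6 9 = 0 := by
  have e1 := h.cocycle 0 1 2 0
  have e2 := h.cocycle 1 3 6 7
  have e3 := h.cocycle 1 4 5 7
  have e4 := h.cocycle 0 1 4 3
  have e5 := h.cocycle 0 1 6 5
  have e6 := h.cocycle 0 1 8 7
  have e7 := h.cocycle 0 1 9 8
  have e8 := h.cocycle 1 2 3 3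
  have e9 := h.cocycle 1 2 4 4
  have e10 := h.cocycle 1 2 5 5
  have e11 := h.cocycle 1 2 6 6
  have e12 := h.cocycle 1 2 7 7
  have e13 := h.cocycle 1 2 9 9
  have e14 := h.cocycle 0 3 5 7
  have e15 := h.cocycle 1 4 6 8
  simp [bracket_def, minor, X_apply, Fin.sum_univ_succ, h.self, h.skew] at e1 e2 e3 e4 e5 e6 e7 e8
  simp [bracket_def, minor, X_apply, Fin.sum_univ_succ, h.self, h.skew]
    at e9 e10 e11 e12 e13 e14 e15
  refine ⟨?_, ?_, ?_, ?_, ?_, ?_, ?_, ?_, ?_, ?_, ?_, ?_, ?_, ?_, ?_⟩ <;> linarith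

theorem IsCocycleCoord.bidegree_one_neg_one {c : Fin 10 → Fin 10 → Fin 10 → ℝ}
    (h : IsCocycleCoord c) (h163 : c 1 6 3 = 0) :
    c 0 5 3 = 0 ∧ c 0 6 4 = 0 ∧ c 2 5 4 = 0 ∧ c 5 6 8 = 0 := by
  have e1 := h.cocycle 1 5 6 7
  have e2 := h.cocycle 0 1 6 3
  have e3 := h.cocycle 1 2 5 3
  have e4 := h.cocycle 1 2 6 4
  simp [bracket_def, minor, X_apply, Fin.sum_univ_succ, h.self, h.skew] at e1 e2 e3 e4
  refine ⟨?_, ?_, ?_, ?_⟩ <;> linarith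

theorem IsCocycleCoord.bidegree_one_one {c : Fin 10 → Fin 10 → Fin 10 → ℝ}
    (h : IsCocycleCoord c) (h017 : c 0 1 7 = 0) :
    c 0 2 9 = 0 := by
  have e1 := h.cocycle 0 1 2 8
  simp [bracket_def, minor, X_apply, Fin.sum_univ_succ, h.self, h.skew] at e1
  linarith

end G10

/-! ### Dimension bounds for cocycles and coboundaries -/

section DimensionBounds

theorem finrank_le_card_of_forall_eq_zero {V ι : Type*} [AddCommGroup V] [Module ℝ V]
    {s : Finset ι} (Z : Submodule ℝ V) (T : V →ₗ[ℝ] (s → ℝ)) (h : ∀ v ∈ Z, T v = 0 → v = 0) :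
    Module.finrank ℝ Z ≤ s.card := by
  have hT : Function.Injective (T.domRestrict Z) := by
    rw [← LinearMap.ker_eq_bot, LinearMap.ker_eq_bot']
    exact fun v hv => Subtype.ext (h v v.2 hv)
  have h1 := LinearMap.finrank_le_finrank_of_injective hT
  rwa [Module.finrank_fintype_fun_eq_card, Fintype.card_coe] at h1

variable {L : Type*} [LieRing L] [LieAlgebra ℝ L] {n : ℕ}

/-- If a derivation is determined by its coordinates in `s`, then there are at least
`n ^ 2 - s.card` independent coboundaries. -/
theorem sq_le_finrank_adjointB2_add_card (X : Module.Basis (Fin n) ℝ L)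
    (s : Finset (Fin n × Fin n))
    (h : ∀ f : L →ₗ[ℝ] L, (∀ x y, f ⁅x, y⁆ = ⁅x, f y⁆ - ⁅y, f x⁆) →
      (∀ t ∈ s, X.coord t.2 (f (X t.1)) = 0) → f = 0) :
    n ^ 2 ≤ Module.finrank ℝ (adjointB2 L) + s.card := by
  have : FiniteDimensional ℝ L := X.finiteDimensional_of_finite
  let d := (LieModule.Cohomology.twoCochain ℝ L L).subtype ∘ₗ LieModule.Cohomology.d₁₂ ℝ L L
  have h1 : Module.finrank ℝ (LinearMap.ker d) ≤ s.card := by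
    refine finrank_le_card_of_forall_eq_zero (LinearMap.ker d) (LinearMap.pi fun t : s =>
      X.coord t.1.2 ∘ₗ LinearMap.applyₗ (X t.1.1)) fun f hf h0 =>
        h f (fun x y => ?_) fun t ht => congrFun h0 ⟨t, ht⟩
    have h1 : LieModule.Cohomology.d₁₂ ℝ L L f x y = 0 :=
      LinearMap.congr_fun₂ (LinearMap.mem_ker.1 hf) x y
    rw [LieModule.Cohomology.d₁₂_apply_apply] at h1
    exact (sub_eq_zero.1 h1).symm
  have h2 : Module.finrank ℝ (adjointB2 L) + Module.finrank ℝ (LinearMap.ker d) = _ :=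
    LinearMap.finrank_range_add_finrank_ker d
  rw [Module.finrank_linearMap, Module.finrank_eq_card_basis X, Fintype.card_fin] at h2
  rw [sq]
  omega

/-- If a cocycle is determined by its coordinates in `s`, then there are at most `s.card`
independent cocycles. -/
theorem finrank_adjointZ2_le_card (X : Module.Basis (Fin n) ℝ L)
    (s : Finset (Fin n × Fin n × Fin n))
    (h : ∀ φ ∈ LieModule.Cohomology.twoCocycle ℝ L L,
      (∀ t ∈ s, X.coord t.2.2 (φ (X t.1) (X t.2.1)) = 0) → φ = 0) :
    Module.finrank ℝ (adjointZ2 L) ≤ s.card := by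
  refine finrank_le_card_of_forall_eq_zero (adjointZ2 L) (LinearMap.pi fun t : s =>
    X.coord t.1.2.2 ∘ₗ LinearMap.applyₗ (X t.1.2.1) ∘ₗ LinearMap.applyₗ (X t.1.1)) ?_
  rintro _ ⟨φ, hφ, rfl⟩ h0
  have h1 : φ = 0 := h φ hφ fun t ht => congrFun h0 ⟨t, ht⟩
  exact congrArg Subtype.val h1

end DimensionBounds

namespace G10

/-! ### Weights -/

/-- The vector `v` is an eigenvector of `ad (X 0)` for the eigenvalue `a`, or zero. -/
def HasWeight (a : ℤ) (v : G10) : Prop := ⁅X 0, v⁆ = (a : ℝ) • v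

theorem hasWeight_iff {a : ℤ} {v : G10} : HasWeight a v ↔ ∀ k, weight k ≠ a → v k = 0 := by
  have h : HasWeight a v ↔ ∀ k, (weight k : ℝ) * v k = a * v k := by
    constructor
    · intro h k
      rw [← lie_X_zero_apply, h, smul_apply]
    · intro h
      ext k
      rw [lie_X_zero_apply, h, smul_apply]
  rw [h]
  refine forall_congr' fun k => ?_
  rw [mul_eq_mul_right_iff, Int.cast_inj, or_iff_not_imp_left]

theorem HasWeight.add {a : ℤ} {u v : G10} (hu : HasWeight a u) (hv : HasWeight a v) :
    HasWeight a (u + v) := by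
  rw [HasWeight, lie_add, hu, hv, smul_add]

theorem HasWeight.neg {a : ℤ} {v : G10} (hv : HasWeight a v) : HasWeight a (-v) := by
  rw [HasWeight, lie_neg, hv, smul_neg]

theorem HasWeight.lie {a b : ℤ} {u v : G10} (hu : HasWeight a u) (hv : HasWeight b v) :
    HasWeight (a + b) ⁅u, v⁆ := by
  rw [HasWeight, leibniz_lie, hu, hv, smul_lie, lie_smul, Int.cast_add, add_smul]

theorem hasWeight_X (j : Fin 10) : HasWeight (weight j) (X j) := lie_X_zero_X j

/-- A linear map that preserves the weights of the basis vectors preserves all weights. -/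
theorem HasWeight.map {f : G10 →ₗ[ℝ] G10} (hf : ∀ j, HasWeight (weight j) (f (X j))) {a : ℤ}
    {v : G10} (hv : HasWeight a v) : HasWeight a (f v) := by
  have h : (LieModule.toEnd ℝ G10 G10 (X 0)) ∘ₗ f = f ∘ₗ (LieModule.toEnd ℝ G10 G10 (X 0)) :=
    X.ext fun j => by
      simp only [LinearMap.comp_apply, LieModule.toEnd_apply_apply, lie_X_zero_X, map_smul]
      exact hf j
  have h' := LinearMap.congr_fun h v
  simp only [LinearMap.comp_apply, LieModule.toEnd_apply_apply] at h'
  rw [HasWeight, h', hv, map_smul]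

/-! ### Derivations -/

theorem finrank_eq_ten : Module.finrank ℝ G10 = 10 := by
  rw [Module.finrank_eq_card_basis X, Fintype.card_fin]

instance : FiniteDimensional ℝ G10 := X.finiteDimensional_of_finite

/-- The coordinates that determine a derivation. -/
def derivationIndex : Finset (Fin 10 × Fin 10) :=
  (Finset.univ.filter fun t => t.1 = 0 ∧ weight t.2 ≠ 0) ∪
    {(1, 1), (1, 7), (3, 3), (3, 5), (5, 3), (5, 5)}

theorem card_derivationIndex : derivationIndex.card = 14 := by decide +kernel

/-- The pairs of basis vectors of equal weight. -/
def weightPairs : List (Fin 10 × Fin 10) :=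
  [(0, 0), (0, 8), (1, 1), (1, 7), (2, 2), (2, 9), (3, 3), (3, 5), (4, 4), (4, 6), (5, 3),
    (5, 5), (6, 4), (6, 6), (7, 1), (7, 7), (8, 0), (8, 8), (9, 2), (9, 9)]

theorem sum_mul_apply_X (f : G10 →ₗ[ℝ] G10) (v : G10) (m : Fin 10) :
    ∑ l, v l * f (X l) m = f v m := by
  have h : X.coord m (f v) = X.coord m (f (∑ l, X.repr v l • X l)) := by rw [X.sum_repr]
  rw [map_sum, map_sum] at h
  refine Eq.trans (Finset.sum_congr rfl fun l _ => ?_) h.symm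
  rw [map_smul, map_smul]
  rfl

/-- `G10` has at most fourteen independent derivations, and they are read off from the coordinates
in `derivationIndex`. -/
theorem derivation_eq_zero {f : G10 →ₗ[ℝ] G10} (hf : ∀ x y, f ⁅x, y⁆ = ⁅x, f y⁆ - ⁅y, f x⁆)
    (h : ∀ t ∈ derivationIndex, f (X t.1) t.2 = 0) : f = 0 := by
  -- As `f (X 0)` has weight zero, `f` preserves weights: `ad (X 0)` acts on the part of `f (X j)`
  -- of another weight both by that weight and by `weight j`.
  have h0 : HasWeight 0 (f (X 0)) :=
    hasWeight_iff.2 fun k hk => h (0, k) (Finset.mem_union_left _ (by simpa using hk))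
  have hw : ∀ j k, weight k ≠ weight j → f (X j) k = 0 := by
    intro j k hjk
    have h1 := hf (X 0) (X j)
    rw [lie_X_zero_X, map_smul] at h1
    have h2 := congrArg (fun v : G10 => v k) h1
    have h3 := hasWeight_iff.1 ((hasWeight_X j).lie h0) k (by rwa [add_zero])
    simp only [sub_eq_add_neg, add_apply, neg_apply, smul_apply, lie_X_zero_apply, h3] at h2
    have h4 : ((weight k : ℝ) - weight j) * f (X j) k = 0 := by linarith
    have h5 : (weight k : ℝ) - weight j ≠ 0 := sub_ne_zero.2 (Int.cast_injective.ne hjk)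
    exact (mul_eq_zero.1 h4).resolve_left h5
  have hD : ∀ i j m, ∑ l, ⁅X i, X j⁆ l * f (X l) m = ⁅X i, f (X j)⁆ m - ⁅X j, f (X i)⁆ m := by
    intro i j m
    rw [sum_mul_apply_X, hf, sub_eq_add_neg, add_apply, neg_apply, sub_eq_add_neg]
  -- The remaining twenty coordinates solve a linear system.
  have k11 := h (1, 1) (by decide)
  have k17 := h (1, 7) (by decide)
  have k33 := h (3, 3) (by decide)
  have k35 := h (3, 5) (by decide)
  have k53 := h (5, 3) (by decide)
  have k55 := h (5, 5) (by decide)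
  have e1 := hD 0 1 1
  have e2 := hD 0 1 7
  have e3 := hD 3 5 1
  have e4 := hD 3 6 0
  have e5 := hD 3 9 4
  have e6 := hD 1 4 5
  have e7 := hD 1 6 3
  have e8 := hD 1 2 0
  have e9 := hD 1 2 8
  have e10 := hD 1 4 3
  have e11 := hD 1 6 5
  have e12 := hD 3 5 7
  have e13 := hD 3 6 8
  have e14 := hD 4 6 9
  simp [bracket_def, minor, X_apply, Fin.sum_univ_succ] at e1 e2 e3 e4 e5 e6 e7
  simp [bracket_def, minor, X_apply, Fin.sum_univ_succ] at e8 e9 e10 e11 e12 e13 e14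
  have hmem : ∀ j k : Fin 10, weight k = weight j → (j, k) ∈ weightPairs := by decide +kernel
  have hzero : ∀ t ∈ weightPairs, f (X t.1) t.2 = 0 := by
    simp only [weightPairs, List.forall_mem_cons, List.not_mem_nil, false_imp_iff,
      implies_true, and_true]
    refine ⟨?_, ?_, ?_, ?_, ?_, ?_, ?_, ?_, ?_, ?_, ?_, ?_, ?_, ?_, ?_, ?_, ?_, ?_, ?_, ?_⟩ <;>
      linarith
  refine X.ext fun j => ext fun k => ?_
  by_cases hjk : weight k = weight j
  · exact hzero _ (hmem j k hjk)
  · exact hw j k hjk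

theorem le_finrank_adjointB2 : 86 ≤ Module.finrank ℝ (adjointB2 G10) := by
  have h := sq_le_finrank_adjointB2_add_card X derivationIndex fun _ => derivation_eq_zero
  rw [card_derivationIndex] at h
  omega

/-! ### Cocycles -/

/-- The coordinates that determine a 2-cocycle. -/
def cocycleIndex : Finset (Fin 10 × Fin 10 × Fin 10) :=
  (Finset.univ.filter fun t => t.1 = 0 ∧ t.2.1 ≠ 0 ∧ weight t.2.2 ≠ weight t.2.1) ∪
    {(0, 1, 1), (0, 1, 7), (1, 2, 0), (1, 2, 8), (1, 4, 3), (1, 4, 5), (1, 6, 3), (1, 6, 5),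
      (1, 8, 1), (1, 8, 7), (1, 9, 0), (1, 9, 8), (3, 5, 1), (3, 5, 7)}

theorem card_cocycleIndex : cocycleIndex.card = 86 := by decide +kernel

theorem isCocycleCoord {φ : LieModule.Cohomology.twoCochain ℝ G10 G10}
    (hφ : φ ∈ LieModule.Cohomology.twoCocycle ℝ G10 G10) :
    IsCocycleCoord fun i j k => φ (X i) (X j) k where
  self i k := by simp
  skew i j k _ := by
    rw [← LieModule.Cohomology.twoCochain_skew, neg_apply]
  cocycle i j k m := by
    have h : LieModule.Cohomology.d₂₃ ℝ G10 G10 φ (X i) (X j) (X k) = 0 := by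
      rw [(LieModule.Cohomology.mem_twoCocycle_iff ℝ G10 G10 φ).1 hφ]
      rfl
    have hs : ∀ (v : G10) (p m : Fin 10), ∑ l, v l * φ (X l) (X p) m = φ v (X p) m := fun v p m =>
      sum_mul_apply_X (φ.1.flip (X p)) v m
    rw [hs, hs, hs]
    have h' := congrArg (fun v : G10 => v m) h
    simp only [LieModule.Cohomology.d₂₃_apply, sub_eq_add_neg, add_apply, neg_apply,
      zero_apply] at h'
    simp only [sub_eq_add_neg]
    exact h'

/-- The coordinates of weight zero of a 2-cochain. -/
def weightTriples : List (Fin 10 × Fin 10 × Fin 10) :=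
  [(0, 1, 1), (0, 1, 7), (0, 2, 2), (0, 2, 9), (0, 3, 3), (0, 3, 5), (0, 4, 4), (0, 4, 6),
    (0, 5, 3), (0, 5, 5), (0, 6, 4), (0, 6, 6), (0, 7, 1), (0, 7, 7), (0, 8, 0), (0, 8, 8),
    (0, 9, 2), (0, 9, 9), (1, 2, 0), (1, 2, 8), (1, 4, 3), (1, 4, 5), (1, 6, 3), (1, 6, 5),
    (1, 8, 1), (1, 8, 7), (1, 9, 0), (1, 9, 8), (2, 3, 4), (2, 3, 6), (2, 5, 4), (2, 5, 6),
    (2, 7, 0), (2, 7, 8), (2, 8, 2), (2, 8, 9), (3, 4, 0), (3, 4, 8), (3, 5, 1), (3, 5, 7),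
    (3, 6, 0), (3, 6, 8), (3, 8, 3), (3, 8, 5), (3, 9, 4), (3, 9, 6), (4, 5, 0), (4, 5, 8),
    (4, 6, 2), (4, 6, 9), (4, 7, 3), (4, 7, 5), (4, 8, 4), (4, 8, 6), (5, 6, 0), (5, 6, 8),
    (5, 8, 3), (5, 8, 5), (5, 9, 4), (5, 9, 6), (6, 7, 3), (6, 7, 5), (6, 8, 4), (6, 8, 6),
    (7, 8, 1), (7, 8, 7), (7, 9, 0), (7, 9, 8), (8, 9, 2), (8, 9, 9)]

/-- A 2-cocycle is determined by its eighty-six coordinates in `cocycleIndex`. -/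
theorem cocycle_eq_zero {φ : LieModule.Cohomology.twoCochain ℝ G10 G10}
    (hφ : φ ∈ LieModule.Cohomology.twoCocycle ℝ G10 G10)
    (h : ∀ t ∈ cocycleIndex, φ (X t.1) (X t.2.1) t.2.2 = 0) : φ = 0 := by
  have hc := isCocycleCoord hφ
  have h0 : ∀ j, HasWeight (weight j) (φ (X 0) (X j)) := by
    intro j
    by_cases hj : j = 0
    · subst hj
      rw [LieModule.Cohomology.twoCochain_alt, HasWeight, lie_zero, smul_zero]
    · exact hasWeight_iff.2 fun k hk =>
        h (0, j, k) (Finset.mem_union_left _ (Finset.mem_filter.2 ⟨Finset.mem_univ _, rfl, hj, hk⟩))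
  -- The cocycle identity for `X 0, X i, X j` expresses `ad (X 0)` on `φ (X i) (X j)` through a
  -- vector of weight `weight i + weight j`.
  have hw : ∀ i j k, weight k ≠ weight i + weight j → φ (X i) (X j) k = 0 := by
    intro i j k hijk
    have h1 : LieModule.Cohomology.d₂₃ ℝ G10 G10 φ (X 0) (X i) (X j) = 0 := by
      rw [(LieModule.Cohomology.mem_twoCocycle_iff ℝ G10 G10 φ).1 hφ]
      rfl
    rw [LieModule.Cohomology.d₂₃_apply, lie_X_zero_X, lie_X_zero_X, map_smul, map_smul,
      LinearMap.smul_apply, LinearMap.smul_apply,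
      ← LieModule.Cohomology.twoCochain_skew φ _ ⁅X i, X j⁆,
      ← LieModule.Cohomology.twoCochain_skew φ _ (X j)] at h1
    have h2 : HasWeight (weight i + weight j)
        (-⁅X i, φ (X 0) (X j)⁆ + ⁅X j, φ (X 0) (X i)⁆ + φ (X 0) ⁅X i, X j⁆) :=
      (((hasWeight_X i).lie (h0 j)).neg.add
        (add_comm (weight j) _ ▸ (hasWeight_X j).lie (h0 i))).add
        (HasWeight.map (f := φ.1 (X 0)) h0 ((hasWeight_X i).lie (hasWeight_X j)))
    have h3 := hasWeight_iff.1 h2 k hijk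
    have h4 := congrArg (fun v : G10 => v k) h1
    simp only [sub_eq_add_neg, add_apply, neg_apply, smul_apply, zero_apply,
      lie_X_zero_apply] at h3 h4
    have h5 : ((weight k : ℝ) - ((weight i + weight j : ℤ) : ℝ)) * φ (X i) (X j) k = 0 := by
      push_cast
      linarith
    exact (mul_eq_zero.1 h5).resolve_left (sub_ne_zero.2 (Int.cast_injective.ne hijk))
  have h143 := h (1, 4, 3) (by decide +kernel)
  have h145 := h (1, 4, 5) (by decide +kernel)
  have h163 := h (1, 6, 3) (by decide +kernel)
  have h165 := h (1, 6, 5) (by decide +kernel)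
  have h120 := h (1, 2, 0) (by decide +kernel)
  have h128 := h (1, 2, 8) (by decide +kernel)
  have h190 := h (1, 9, 0) (by decide +kernel)
  have h198 := h (1, 9, 8) (by decide +kernel)
  have h011 := h (0, 1, 1) (by decide +kernel)
  have h017 := h (0, 1, 7) (by decide +kernel)
  have h181 := h (1, 8, 1) (by decide +kernel)
  have h187 := h (1, 8, 7) (by decide +kernel)
  have h351 := h (3, 5, 1) (by decide +kernel)
  have h357 := h (3, 5, 7) (by decide +kernel)
  obtain ⟨h781, h790, h892⟩ := hc.bidegree_neg_two_neg_two
  obtain ⟨h340, h385, h396, h475, h486⟩ := hc.bidegree_neg_two_zero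
  obtain ⟨h071, h080, h092, h270, h282, h360, h383, h394, h450, h462, h473, h484, h585, h596, h675,
    h686, h787, h798, h899⟩ := hc.bidegree_neg_one_neg_one h181 h190 h351
  obtain ⟨h035, h046, h236, h348⟩ := hc.bidegree_neg_one_one h145
  obtain ⟨h560, h583, h594, h673, h684⟩ := hc.bidegree_zero_neg_two
  obtain ⟨h022, h033, h044, h055, h066, h077, h088, h099, h234, h256, h278, h289, h368, h458, h469⟩
    := hc.bidegree_zero_zero h011 h120 h143 h165 h187 h198 h357
  obtain ⟨h053, h064, h254, h568⟩ := hc.bidegree_one_neg_one h163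
  have h029 := hc.bidegree_one_one h017
  have hzero : ∀ t ∈ weightTriples, φ (X t.1) (X t.2.1) t.2.2 = 0 := by
    simp only [weightTriples, List.forall_mem_cons, List.not_mem_nil, false_imp_iff, implies_true,
      and_true]
    refine ⟨?_, ?_, ?_, ?_, ?_, ?_, ?_, ?_, ?_, ?_, ?_, ?_, ?_, ?_, ?_, ?_, ?_, ?_, ?_, ?_, ?_,
      ?_, ?_, ?_, ?_, ?_, ?_, ?_, ?_, ?_, ?_, ?_, ?_, ?_, ?_, ?_, ?_, ?_, ?_, ?_, ?_, ?_, ?_, ?_,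
      ?_, ?_, ?_, ?_, ?_, ?_, ?_, ?_, ?_, ?_, ?_, ?_, ?_, ?_, ?_, ?_, ?_, ?_, ?_, ?_, ?_, ?_, ?_,
      ?_, ?_, ?_⟩ <;>
      assumption
  have hmem : ∀ i j k : Fin 10, i < j → weight k = weight i + weight j →
      (i, j, k) ∈ weightTriples := by decide +kernel
  have hlt : ∀ i j, i < j → φ (X i) (X j) = 0 := by
    intro i j hij
    ext k
    by_cases hijk : weight k = weight i + weight j
    · exact hzero _ (hmem i j k hij hijk)
    · exact hw i j k hijk
  refine Subtype.ext (X.ext fun i => X.ext fun j => ?_)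
  change φ (X i) (X j) = 0
  rcases lt_trichotomy i j with hij | rfl | hij
  · exact hlt i j hij
  · exact LieModule.Cohomology.twoCochain_alt φ _
  · rw [← LieModule.Cohomology.twoCochain_skew, hlt j i hij, neg_zero]

theorem finrank_adjointZ2_le : Module.finrank ℝ (adjointZ2 G10) ≤ 86 := by
  have h := finrank_adjointZ2_le_card X cocycleIndex fun _ => cocycle_eq_zero
  rwa [card_cocycleIndex] at h

theorem finrank_adjointB2 : Module.finrank ℝ (adjointB2 G10) = 86 :=
  le_antisymm ((Submodule.finrank_mono (adjointB2_le_adjointZ2 G10)).trans finrank_adjointZ2_le)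
    le_finrank_adjointB2

theorem finrank_adjointZ2 : Module.finrank ℝ (adjointZ2 G10) = 86 :=
  le_antisymm finrank_adjointZ2_le
    (le_finrank_adjointB2.trans (Submodule.finrank_mono (adjointB2_le_adjointZ2 G10)))

theorem subsingleton_adjointH2 : Subsingleton (adjointH2 G10) := by
  have h : adjointB2 G10 = adjointZ2 G10 :=
    Submodule.eq_of_le_of_finrank_eq (adjointB2_le_adjointZ2 G10)
      (finrank_adjointB2.trans finrank_adjointZ2.symm)
  rw [adjointH2, subquotient, h, Submodule.submoduleOf_self]
  infer_instance

theorem not_isReductiveLie_of_lieEquiv {H : Type*} [LieRing H] [LieAlgebra ℝ H]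
    (e : H ≃ₗ⁅ℝ⁆ G10) : ¬ IsReductiveLie H := by
  intro h
  have hmem : X 7 ∈ abelianIdeal := by
    intro i hi
    rw [X_apply, if_neg]
    rintro rfl
    exact absurd hi (by decide)
  have h1 := h.lie_eq_zero_of_mem_abelian_ideal (abelianIdeal.comap (e : H →ₗ⁅ℝ⁆ G10))
    (fun x hx y hy => e.injective <| by
      refine (LieEquiv.map_lie e x y).trans (Eq.trans ?_ (map_zero e.toLieHom).symm)
      exact lie_eq_zero_of_mem_abelianIdeal (LieIdeal.mem_comap.1 hx) (LieIdeal.mem_comap.1 hy))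
    (x := e.symm (X 7)) (LieIdeal.mem_comap.2 (by simpa using hmem)) (e.symm (X 0))
  rw [← LieEquiv.map_lie, ← e.symm.map_zero] at h1
  have h2 := congrArg (fun v : G10 => v 7) (e.symm.injective h1)
  simp [bracket_def, minor, X_apply] at h2

end G10

theorem mainTheorem7 :
    -- `G10` has dimension ten and is the semidirect sum of `sl(2, ℝ)` and its radical, on which
    -- `sl(2, ℝ)` acts by the sum of the adjoint and two standard representations
    Module.finrank ℝ G10 = 10 ∧
    (LieAlgebra.radical ℝ G10).toSubmodule =
      Submodule.span ℝ (G10.X '' {i : Fin 10 | 3 ≤ i}) ∧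
    (∃ (ψ : LieAlgebra.SpecialLinear.sl (Fin 2) ℝ →ₗ⁅ℝ⁆
          LieDerivation ℝ (LieAlgebra.radical ℝ G10) (LieAlgebra.radical ℝ G10))
        (φ : G10 ≃ₗ⁅ℝ⁆ LieAlgebra.SemiDirectSum (LieAlgebra.radical ℝ G10)
          (LieAlgebra.SpecialLinear.sl (Fin 2) ℝ) ψ)
        (ρ : LieAlgebra.radical ℝ G10 ≃ₗ[ℝ]
          LieAlgebra.SpecialLinear.sl (Fin 2) ℝ × (Fin 2 → ℝ) × (Fin 2 → ℝ)),
        (∀ r : LieAlgebra.radical ℝ G10, φ (r : G10) = LieAlgebra.SemiDirectSum.inl ψ r) ∧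
        ∀ (A : LieAlgebra.SpecialLinear.sl (Fin 2) ℝ) (r : LieAlgebra.radical ℝ G10),
          ρ (ψ A r) = (⁅A, (ρ r).1⁆, A.val.mulVec (ρ r).2.1, A.val.mulVec (ρ r).2.2)) ∧
    -- the symmetrization of the quadratic polynomial is a non-degenerate Casimir operator
    (∃ q : Matrix (Fin 10) (Fin 10) ℝ, q.IsSymm ∧
        ∑ a, ∑ b, MvPolynomial.C (q a b) * MvPolynomial.X a * MvPolynomial.X b =
          G10.casimirPolynomial ∧
        IsUnit q.det ∧
        quadraticOperator G10.X q ∈ Subalgebra.center ℝ (UniversalEnvelopingAlgebra ℝ G10)) ∧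
    IsQuasiClassical G10 ∧
    ¬ IsReductiveLie G10 ∧
    -- the second adjoint cohomology
    Module.finrank ℝ (adjointZ2 G10) = 86 ∧
    Module.finrank ℝ (adjointB2 G10) = 86 ∧
    Subsingleton (adjointH2 G10) ∧
    -- rigidity, and the consequences for contractions
    IsRigidLie G10 ∧
    (∀ (H : Type*) [LieRing H] [LieAlgebra ℝ H] [FiniteDimensional ℝ H] [TopologicalSpace H]
        [IsTopologicalAddGroup H] [ContinuousSMul ℝ H] [T2Space H],
        ContractsOnto H G10 → Nonempty (H ≃ₗ⁅ℝ⁆ G10) ∧ ¬ IsReductiveLie H) := by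
  have := G10.subsingleton_adjointH2
  have hrigid : IsRigidLie G10 := isRigidLie_of_subsingleton_adjointH2
  refine ⟨G10.finrank_eq_ten, ?_, ⟨G10.leviAction, ?_, G10.radicalEquiv, ?_,
    G10.radicalEquiv_leviAction⟩, ⟨G10.casimirMatrix, G10.isSymm_casimirMatrix,
    G10.sum_casimirMatrix, G10.isUnit_det_casimirMatrix,
    G10.mem_center_of_commute_ι G10.commute_quadraticOperator⟩, G10.isQuasiClassical,
    G10.not_isReductiveLie_of_lieEquiv LieEquiv.refl, G10.finrank_adjointZ2,
    G10.finrank_adjointB2, G10.subsingleton_adjointH2, hrigid, ?_⟩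
  · rw [G10.radical_eq_nilIdeal, G10.nilIdeal_toSubmodule]
  · exact (LieEquiv.ofBijective G10.ofSemiDirectSum G10.bijective_ofSemiDirectSum).symm
  · intro r
    rw [LieEquiv.symm_apply_eq]
    change (r : G10) = G10.ofSemiDirectSum (LieAlgebra.SemiDirectSum.inl _ r)
    simp [G10.ofSemiDirectSum_apply]
  · intro H _ _ _ _ _ _ _ hH
    obtain ⟨e⟩ := hH.nonempty_lieEquiv hrigid
    exact ⟨⟨e⟩, G10.not_isReductiveLie_of_lieEquiv e⟩
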